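/- Let $n\ge 4$ and $h>0$. Work in the projective (Lorentz) model of $\mathbb{H}^n$: points of $\mathbb{P}^n(\mathbb{R})$ are represented by non-zero vectors of $\mathbb{R}^{n+1}$ with the form $\langle x,y\rangle=-x^0y^0+x^1y^1+\dots+x^ny^n$, the points of $\mathbb{H}^n$ are those with $\langle x,x\rangle<0$ (represented by $\langle x,x\rangle=-1$, $x^0>0$), *outer points* are those with $\langle x,x\rangle>0$, and the *polar hyperplane* of an outer point $A$ is $\{x\in\mathbb{H}^n:\langle x,A\rangle=0\}$. The *hyperball* of height $h$ with base hyperplane $\beta$ is $\{x: d(x,\beta)\le h\}$. Let $\mathcal{B}$ be a set of hyperplanes whose hyperballs of height $h$ form a packing (pairwise disjoint interiors) that is *saturated*: neither a horoball nor a further hyperball of height $h$ can be added without overlapping interiors. **The construction.** The Dirichlet–Voronoi cell of $\beta\in\mathcal{B}$ is $\{x: d(x,\beta)\le d(x,\gamma)\text{ for all }\gamma\in\mathcal{B}\}$. For a vertex $P$ of such a cell let $S(P)$ be the set of all $b$ with $\langle b,b\rangle=1$ and $\langle P,b\rangle<0$ for which the polar hyperplane of $b$ belongs to $\mathcal{B}$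 and its cell contains $P$. For a set $S\subseteq S(P)$ that spans $\mathbb{R}^{n+1}$, let $D'(S)$ be the polytope in projective space given by $\langle x,b\rangle\le 0$ ($b\in S$), and let $D(S)\subset\mathbb{H}^n$ be obtained from $D'(S)$ by cutting off every outer vertex $A$ with its polar hyperplane. A *cutting point* of $S$ is an outer point $A$ that is the only common point of the base hyperplanes (polar to elements of $S$) through it, these base hyperplanes being non-adjacent, i.e. no vertex of $D'(S)$ lies on all of them. A *cut* of $D(S)$ decomposes it along polar hyperplanes of cutting points of $S$ into polytopes $D(T)$ with non-overlapping interiors, where each $T\subsetneq S$ spans $\mathbb{R}^{n+1}$ and $D(T)$ is the intersection of $D(S)$ with half-spaces bounded by polar hyperplanes of cutting points of $S$. The algorithm starts, for every vertex $P$ of the Dirichlet–Voronoi cells, with $D(S(P))$, and cuts the polytopes repeatedly as long as they have cutting points. **Theorem.** 1. The polytopes $D(S(P))$ form a decomposition of $\mathbb{H}^n$. 2. For every vertex $P$ the set $S(P)$ is finite, every polytope $D(S)$ with $S\subseteq S(P)$ spanning $\mathbb{R}^{n+1}$ that has a cutting point admits a cut, and the algorithm has a result. 3. Whatever cuts are chosen,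 the algorithm decomposes every $D(S(P))$ into finitely many polytopes $D(T)$, and all these together form a decomposition of $\mathbb{H}^n$. Each $D(T)$ is a truncated simplex: $T=\{B_0,\dots,B_n\}$ is linearly independent, $\langle B_i,B_j\rangle<-1$ for $i\ne j$ (so the edges of the simplex pass through $\mathbb{H}^n$), and $D(T)$ is the hyperbolic part $\{x\in\mathbb{H}^n: x=\sum_i c_iB_i,\ c_i\ge 0\}$ of the simplex with outer vertices $B_i$, truncated by the polar hyperplanes of all $B_i$, i.e. restricted to $\langle x,B_i\rangle\le 0$ for all $i$. These polar hyperplanes are distinct members of $\mathcal{B}$, and in $D(T)$ their hyperballs form a packing (their intersections with $D(T)$ have pairwise disjoint interiors). Here a *decomposition* of a set is a locally finite family of compact sets with non-empty, pairwise disjoint interiors whose union is the set. -/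

import Mathlib

open Set

noncomputable section

namespace HyperballPacking

/-! ## Hyperbolic `n`-space in Lorentz space -/

/-- The vector space `ℝ^{n+1}` whose non-zero vectors represent the points of projective `n`-space. -/
abbrev Vec (n : ℕ) : Type := Fin (n + 1) → ℝ

/-- The Lorentz form `⟨x, y⟩ = -x⁰y⁰ + x¹y¹ + ⋯ + xⁿyⁿ`. -/
def lor {n : ℕ} (x y : Vec n) : ℝ := -(x 0 * y 0) + ∑ i : Fin n, x i.succ * y i.succ

/-- Hyperbolic `n`-space: every point of the interior of the quadric `⟨x, x⟩ = 0` has exactly one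
representative with `⟨x, x⟩ = -1` and `x⁰ > 0`. The topology is the subspace topology. -/
abbrev Hyp (n : ℕ) : Type := {x : Vec n // lor x x = -1 ∧ 0 < x 0}

/-- The hyperbolic distance (curvature `-1`). -/
def hdist {n : ℕ} (x y : Hyp n) : ℝ := Real.arcosh (-lor x.1 y.1)

/-- The polar hyperplane of the projective point `[a]`, as a subset of hyperbolic space. -/
def polarPlane {n : ℕ} (a : Vec n) : Set (Hyp n) := {x | lor x.1 a = 0}

/-- The hyperplanes of hyperbolic space are the polar hyperplanes of the outer points. -/
def IsHyperplane {n : ℕ} (β : Set (Hyp n)) : Prop := ∃ b : Vec n, 0 < lor b b ∧ β = polarPlane b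

/-- Distance of a point from a (non-empty) set. -/
def distTo {n : ℕ} (x : Hyp n) (β : Set (Hyp n)) : ℝ := ⨅ y : β, hdist x y.1

/-- The hyperball of height `h` with base plane `β`. -/
def hyperball {n : ℕ} (h : ℝ) (β : Set (Hyp n)) : Set (Hyp n) := {x | distTo x β ≤ h}

/-- Horoballs. The non-zero light-like vector `u` represents the centre, and its scaling
determines the size, so that all horoballs are obtained. -/
def IsHoroball {n : ℕ} (C : Set (Hyp n)) : Prop :=
  ∃ u : Vec n, lor u u = 0 ∧ 0 < u 0 ∧ C = {x | -lor x.1 u ≤ 1}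

/-! ## Saturated congruent hyperball packings -/

/-- The hyperballs of height `h` about the hyperplanes in `𝓑` form a packing: their interiors
are pairwise disjoint. -/
structure IsHyperballPacking {n : ℕ} (h : ℝ) (𝓑 : Set (Set (Hyp n))) : Prop where
  isHyperplane : ∀ β ∈ 𝓑, IsHyperplane β
  disjoint : ∀ β ∈ 𝓑, ∀ γ ∈ 𝓑, β ≠ γ →
    Disjoint (interior (hyperball h β)) (interior (hyperball h γ))

/-- The set `C` can be added to the hyperballs of height `h` about the hyperplanes in `𝓑`
without overlapping. -/
def CanBeAdded {n : ℕ} (h : ℝ) (𝓑 : Set (Set (Hyp n))) (C : Set (Hyp n)) : Prop :=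
  ∀ β ∈ 𝓑, Disjoint (interior C) (interior (hyperball h β))

/-- The packing is saturated: no new non-compact ball, that is, neither a horoball nor a further
congruent hyperball, can be added to it. -/
structure IsSaturated {n : ℕ} (h : ℝ) (𝓑 : Set (Set (Hyp n))) : Prop where
  no_horoball : ∀ C : Set (Hyp n), IsHoroball C → ¬ CanBeAdded h 𝓑 C
  no_hyperball : ∀ β : Set (Hyp n), IsHyperplane β → β ∉ 𝓑 → ¬ CanBeAdded h 𝓑 (hyperball h β)

/-! ## The Dirichlet–Voronoi decomposition -/

/-- The Dirichlet–Voronoi cell of the hyperball with base plane `β`. A tangent of length `ℓ` from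
`x` to the hypersphere of height `h` about `β` satisfies `cosh ℓ = sinh (distTo x β) / sinh h`, so
the radical hyperplane of two congruent hyperspheres is the locus of the points equidistant from
the two base planes. -/
def dvCell {n : ℕ} (𝓑 : Set (Set (Hyp n))) (β : Set (Hyp n)) : Set (Hyp n) :=
  {x | ∀ γ ∈ 𝓑, distTo x β ≤ distTo x γ}

/-- `P` is a vertex of the set `C`: it is in `C` but inside no geodesic segment between points
of `C`. -/
def IsVertex {n : ℕ} (C : Set (Hyp n)) (P : Hyp n) : Prop :=
  P ∈ C ∧ ∀ x ∈ C, ∀ y ∈ C, ∀ s t : ℝ, 0 < s → 0 < t → P.1 = s • x.1 + t • y.1 → x = P ∧ y = P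

/-- `P` is a (proper) vertex of the Dirichlet–Voronoi decomposition. -/
def IsDVVertex {n : ℕ} (𝓑 : Set (Set (Hyp n))) (P : Hyp n) : Prop :=
  ∃ β ∈ 𝓑, IsVertex (dvCell 𝓑 β) P

/-- The normalized poles `b` of the base planes `β_i(P)` of the hyperballs whose Dirichlet–Voronoi
cells meet at `P`; the sign is chosen such that `P` is in the half-space `⟨x, b⟩ ≤ 0`. -/
def poles {n : ℕ} (𝓑 : Set (Set (Hyp n))) (P : Hyp n) : Set (Vec n) :=
  {b | lor b b = 1 ∧ lor P.1 b < 0 ∧ polarPlane b ∈ 𝓑 ∧ P ∈ dvCell 𝓑 (polarPlane b)}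

/-! ## The polytopes cut out by base planes and polar hyperplanes

Below, a finite set of base planes with chosen half-spaces is given by the set `S` of their poles;
the half-space of `b ∈ S` is `⟨x, b⟩ ≤ 0`. -/

/-- The cone of vectors representing the points of the non-compact polytope in projective space
which is the intersection of the half-spaces. -/
def halfspaceCone {n : ℕ} (S : Set (Vec n)) : Set (Vec n) := {x | ∀ b ∈ S, lor x b ≤ 0}

/-- `[A]` is a vertex of the intersection of the half-spaces in projective space, that is, `A`
spans an extreme ray of the cone. -/
def IsProjVertex {n : ℕ} (S : Set (Vec n)) (A : Vec n) : Prop :=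
  A ≠ 0 ∧ A ∈ halfspaceCone S ∧
    ∀ x ∈ halfspaceCone S, ∀ y ∈ halfspaceCone S, x + y = A → ∃ c : ℝ, x = c • A

/-- The polytope obtained from the intersection of the half-spaces by cutting off its outer
vertices `A` with their polar hyperplanes; the part cut off is the one on the side of `A`. -/
def cutPolytope {n : ℕ} (S : Set (Vec n)) : Set (Hyp n) :=
  {x | x.1 ∈ halfspaceCone S ∧ ∀ A : Vec n, IsProjVertex S A → 0 < lor A A → lor x.1 A ≤ 0}

/-- `A` is an outer point in which non-adjacent base planes of the polytope meet: `[A]` is the only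
common point of the base planes through it, and no vertex of the intersection of the half-spaces
lies on all of these base planes. -/
def IsCuttingPoint {n : ℕ} (S : Set (Vec n)) (A : Vec n) : Prop :=
  0 < lor A A ∧
  (∀ x : Vec n, (∀ b ∈ S, lor A b = 0 → lor x b = 0) → ∃ c : ℝ, x = c • A) ∧
  ¬ ∃ A' : Vec n, IsProjVertex S A' ∧ ∀ b ∈ S, lor A b = 0 → lor A' b = 0

/-- A cut of the polytope with poles `S` along polar hyperplanes of cutting points into
polytopes of the same kind, each of which has fewer base planes. (If the polar hyperplane of a
single cutting point `A` cuts it into two such polytopes, then this is the case of the two parts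
`⟨x, A⟩ ≤ 0` and `⟨x, -A⟩ ≤ 0`.) -/
structure IsCut {n : ℕ} (S : Set (Vec n)) (𝒞 : Set (Set (Vec n))) : Prop where
  ssubset : ∀ T ∈ 𝒞, T ⊂ S
  span : ∀ T ∈ 𝒞, Submodule.span ℝ T = ⊤
  walls : ∀ T ∈ 𝒞, ∃ 𝒜 : Set (Vec n), (∀ A ∈ 𝒜, IsCuttingPoint S A) ∧
    cutPolytope T = cutPolytope S ∩ {x | ∀ A ∈ 𝒜, lor x.1 A ≤ 0}
  covers : cutPolytope S = ⋃ T ∈ 𝒞, cutPolytope T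
  disjoint : ∀ T ∈ 𝒞, ∀ T' ∈ 𝒞, T ≠ T' →
    Disjoint (interior (cutPolytope T)) (interior (cutPolytope T'))

/-- `𝒯` is a possible result of the cutting procedure for the polytope with poles `S`: if there is
no cutting point then the polytope is kept, otherwise it is cut and the procedure is applied to
each part. -/
inductive CutResult {n : ℕ} : Set (Vec n) → Set (Set (Vec n)) → Prop
  | keep (S : Set (Vec n)) (hS : ∀ A, ¬ IsCuttingPoint S A) : CutResult S {S}
  | cut (S : Set (Vec n)) (𝒞 : Set (Set (Vec n))) (hA : ∃ A, IsCuttingPoint S A)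
      (hS : IsCut S 𝒞) (r : Set (Vec n) → Set (Set (Vec n)))
      (hr : ∀ T ∈ 𝒞, CutResult T (r T)) : CutResult S (⋃ T ∈ 𝒞, r T)

/-! ## Decompositions and truncated simplices -/

/-- A decomposition of `X` into the compact tiles `D i`: they have interior points, cover `X`, do
not overlap, and are locally finite. -/
structure IsDecomposition {n : ℕ} {ι : Type} (X : Set (Hyp n)) (D : ι → Set (Hyp n)) : Prop where
  isCompact : ∀ i, IsCompact (D i)
  nonempty : ∀ i, (interior (D i)).Nonempty
  covers : ⋃ i, D i = X
  disjoint : ∀ i j, i ≠ j → Disjoint (interior (D i)) (interior (D j))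
  locallyFinite : LocallyFinite D

/-- `D` is the truncated simplex with the outer vertices `B 0, …, B n`: these are in general
position, each edge passes through hyperbolic space (so the polar hyperplanes of the vertices are
pairwise ultraparallel), and `D` is the hyperbolic part of the simplex truncated by the polar
hyperplanes of all its vertices. -/
structure IsTruncatedSimplex {n : ℕ} (B : Fin (n + 1) → Vec n) (D : Set (Hyp n)) : Prop where
  linearIndependent : LinearIndependent ℝ B
  outer : ∀ i, lor (B i) (B i) = 1
  edge : ∀ i j, i ≠ j → lor (B i) (B j) < -1
  eq : D = {x | (∃ c : Fin (n + 1) → ℝ, (∀ i, 0 ≤ c i) ∧ x.1 = ∑ i, c i • B i) ∧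
    ∀ i, lor x.1 (B i) ≤ 0}

end HyperballPacking

end

noncomputable section

namespace HyperballPacking

open Filter Topology

/-! ### The Lorentz form -/

section Lorentz

variable {n : ℕ}

/-! Everything is translated into convex cones in Lorentz space. A hyperball of height `h` about the
polar hyperplane of a unit pole `b` is `|⟨x, b⟩| ≤ sinh h`, so comparing distances means comparing
`|⟨x, b⟩|`. The packing makes the base planes pairwise ultraparallel, and for two poles in `S(P)`
the choice of sign gives `⟨b, b'⟩ < -1` (`lor_lt_of_mem_poles`). Every vertex of `D'(S)` lies on two
such planes and is therefore outer. Hence all vertices are truncated, and `D(S)` consists of the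
points with `⟨x, b⟩ ≤ 0` for `b ∈ S` that also lie in the cone generated by `S`
(`PoleConfig.cutPolytope_eq`). This cone is handled through its dual description `dualCone S`.

The polytopes `D(S(P))` come from linear programming. Choose one pole of each base plane; the
vectors `p` with `⟨p, g⟩ ≤ -1` for all chosen `g` form a convex set `farCone G`. Saturation by
horoballs keeps null vectors out of it, so once it contains a future timelike vector it lies inside
the future light cone. For `x` in the region of `G`, maximize `⟨x, p⟩` over this set. An extreme
maximizer represents a Dirichlet–Voronoi vertex `P`, its tight constraints are poles of `P`, and
optimality says that `x` is in the cone generated by `S(P)` (`exists_mem_cutPolytope`). Two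
polytopes are separated by a base plane or, within one region, by the hyperplane orthogonal to the
difference of the two rescaled vertices (`disjoint_interior_cutPolytope`). Local finiteness holds
because a tile near `x` forces its vertex, and so its poles, into a bounded set
(`locallyFinite_cutPolytope`).

For `T ⊆ S` the polytope `D(T)` is the part of `D(S)` in the cone generated by `T`
(`PoleConfig.cutPolytope_subset`), so cutting `D(S)` is subdividing a cone. If `S` without `b₀`
still spans, the cone of `S` is the cone of `S \ {b₀}` together with the cones joining `b₀` to the
facets visible from it (`PoleConfig.mem_dualCone_diff_or`, `PoleConfig.exists_isCut`). A cutting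
point guarantees such a `b₀` (`IsCuttingPoint.exists_span`), and the procedure stops because the
finite pole sets shrink. Without cutting points `S` is linearly independent
(`PoleConfig.linearIndependent`): a redundant `b₀` would lie in the cone of the other poles while
having negative products with all of them, which gives `⟨b₀, b₀⟩ ≤ 0`. -/

lemma lor_comm (x y : Vec n) : lor x y = lor y x := by
  simp only [lor, mul_comm]

lemma lor_add_left (x y z : Vec n) : lor (x + y) z = lor x z + lor y z := by
  simp only [lor, Pi.add_apply, add_mul, Finset.sum_add_distrib]; ring

lemma lor_smul_left (c : ℝ) (x z : Vec n) : lor (c • x) z = c * lor x z := by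
  simp only [lor, Pi.smul_apply, smul_eq_mul, mul_add, Finset.mul_sum, mul_neg, mul_assoc]

lemma lor_add_right (x y z : Vec n) : lor x (y + z) = lor x y + lor x z := by
  rw [lor_comm, lor_add_left, lor_comm y, lor_comm z]

lemma lor_smul_right (c : ℝ) (x z : Vec n) : lor x (c • z) = c * lor x z := by
  rw [lor_comm, lor_smul_left, lor_comm z]

lemma lor_neg_left (x z : Vec n) : lor (-x) z = -lor x z := by
  rw [← neg_one_smul ℝ, lor_smul_left, neg_one_mul]

lemma lor_neg_right (x z : Vec n) : lor x (-z) = -lor x z := by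
  rw [lor_comm, lor_neg_left, lor_comm z]

lemma lor_sub_left (x y z : Vec n) : lor (x - y) z = lor x z - lor y z := by
  rw [sub_eq_add_neg, lor_add_left, lor_neg_left, ← sub_eq_add_neg]

lemma lor_sub_right (x y z : Vec n) : lor x (y - z) = lor x y - lor x z := by
  rw [sub_eq_add_neg, lor_add_right, lor_neg_right, ← sub_eq_add_neg]

lemma lor_zero_left (z : Vec n) : lor 0 z = 0 := by simp [lor]

lemma lor_zero_right (z : Vec n) : lor z 0 = 0 := by simp [lor]

/-- The linear form `x ↦ ⟨x, b⟩`. -/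
def lorLin (b : Vec n) : Vec n →ₗ[ℝ] ℝ where
  toFun x := lor x b
  map_add' x y := lor_add_left x y b
  map_smul' c x := lor_smul_left c x b

@[simp] lemma lorLin_apply (b x : Vec n) : lorLin b x = lor x b := rfl

lemma lor_sum_left {ι : Type*} (s : Finset ι) (f : ι → Vec n) (z : Vec n) :
    lor (∑ i ∈ s, f i) z = ∑ i ∈ s, lor (f i) z := map_sum (lorLin z) f s

lemma lor_sum_right {ι : Type*} (s : Finset ι) (f : ι → Vec n) (z : Vec n) :
    lor z (∑ i ∈ s, f i) = ∑ i ∈ s, lor z (f i) := by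
  rw [lor_comm, lor_sum_left]; simp only [lor_comm]

lemma continuous_lor : Continuous fun p : Vec n × Vec n => lor p.1 p.2 := by
  unfold lor; fun_prop

@[fun_prop]
lemma continuous_lor_comp {X : Type*} [TopologicalSpace X] {f g : X → Vec n}
    (hf : Continuous f) (hg : Continuous g) : Continuous fun x => lor (f x) (g x) :=
  continuous_lor.comp (hf.prodMk hg)

lemma lor_nondegenerate {v : Vec n} (h : ∀ x, lor x v = 0) : v = 0 := by
  have h0 := h (Pi.single 0 1)
  have hs : ∀ i : Fin n, v i.succ = 0 := fun i => by
    have := h (Pi.single i.succ 1)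
    simpa [lor, Pi.single_apply, (Fin.succ_ne_zero _).symm] using this
  have h1 : v 0 = 0 := by
    simpa [lor, Pi.single_apply] using h0
  funext i
  exact Fin.cases h1 hs i

lemma eq_zero_of_span {S : Set (Vec n)} (hS : Submodule.span ℝ S = ⊤) {v : Vec n}
    (h : ∀ b ∈ S, lor v b = 0) : v = 0 := by
  apply lor_nondegenerate
  intro x
  have hx : x ∈ Submodule.span ℝ S := hS ▸ Submodule.mem_top
  have : Submodule.span ℝ S ≤ LinearMap.ker (lorLin v) :=
    Submodule.span_le.2 fun b hb => by simpa [lor_comm] using h b hb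
  simpa using this hx

lemma exists_lor_eq (f : Vec n →ₗ[ℝ] ℝ) : ∃ v : Vec n, ∀ x, lor v x = f x := by
  let v : Vec n := fun i => Fin.cases (-f (Pi.single 0 1)) (fun j => f (Pi.single j.succ 1)) i
  refine ⟨v, fun x => ?_⟩
  have : x = ∑ i, x i • (Pi.single i 1 : Vec n) := by
    simpa using (Finset.univ_sum_single x).symm.trans (by simp [← Pi.single_smul])
  conv_rhs => rw [this]
  simp only [Fin.sum_univ_succ, lor, v]
  simp [mul_comm]

lemma span_eq_top_of_orthogonal {S : Set (Vec n)} (h : ∀ v : Vec n, (∀ b ∈ S, lor v b = 0) → v = 0) :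
    Submodule.span ℝ S = ⊤ := by
  by_contra hne
  obtain ⟨f, hf, hle⟩ := Submodule.exists_le_ker_of_lt_top _ (lt_top_iff_ne_top.2 hne)
  obtain ⟨v, hv⟩ := exists_lor_eq f
  apply hf
  have hv0 : v = 0 := h v fun b hb => by rw [hv]; exact hle (Submodule.subset_span hb)
  ext x
  simp [← hv, hv0, lor_zero_left]

/-! ### Timelike vectors -/

lemma sum_mul_sq_le (x y : Vec n) :
    (∑ i : Fin n, x i.succ * y i.succ) ^ 2 ≤
      (∑ i : Fin n, x i.succ * x i.succ) * ∑ i : Fin n, y i.succ * y i.succ := by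
  simpa only [sq] using
    Finset.sum_mul_sq_le_sq_mul_sq Finset.univ (fun i : Fin n => x i.succ) fun i => y i.succ

lemma spatial_nonneg (x : Vec n) : 0 ≤ ∑ i : Fin n, x i.succ * x i.succ :=
  Finset.sum_nonneg fun _ _ => mul_self_nonneg _

lemma lor_self_pos_of_orthogonal {p v : Vec n} (hp : lor p p < 0) (h : lor p v = 0) (hv : v ≠ 0) :
    0 < lor v v := by
  have hcs := sum_mul_sq_le p v
  have hnn := spatial_nonneg v
  have hpn := spatial_nonneg p
  simp only [lor] at hp h ⊢
  set a := ∑ i : Fin n, p i.succ * p i.succ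
  set c := ∑ i : Fin n, v i.succ * v i.succ with hc
  have hd : (∑ i : Fin n, p i.succ * v i.succ) = p 0 * v 0 := by linarith
  rw [hd] at hcs
  have hp0 : 0 < p 0 * p 0 := by linarith
  have hcpos : 0 < c := by
    rcases hnn.lt_or_eq with h1 | h1
    · exact h1
    · exfalso
      apply hv
      have hs : ∀ i : Fin n, v i.succ = 0 := by
        intro i
        have := (Finset.sum_eq_zero_iff_of_nonneg (fun i _ => mul_self_nonneg (v (Fin.succ i)))).1
          (hc.symm.trans h1.symm) i (Finset.mem_univ _)
        simpa using this
      have : p 0 * v 0 = 0 := by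
        rw [← h1] at hcs
        nlinarith [sq_nonneg (p 0 * v 0)]
      have hv0 : v 0 = 0 := by
        rcases mul_eq_zero.1 this with h2 | h2
        · rw [h2] at hp0; simp at hp0
        · exact h2
      funext i
      exact Fin.cases hv0 hs i
  by_contra hcon
  have : p 0 * p 0 * c ≤ a * c := by
    have : c ≤ v 0 * v 0 := by linarith
    nlinarith
  nlinarith

lemma reverse_cauchy_schwarz {p : Vec n} (hp : lor p p = -1) (v : Vec n) :
    0 ≤ lor v v + lor p v ^ 2 := by
  have h1 : lor p (v + lor p v • p) = 0 := by
    rw [lor_add_right, lor_smul_right, hp]; ring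
  have h2 : lor (v + lor p v • p) (v + lor p v • p) = lor v v + lor p v ^ 2 := by
    simp only [lor_add_right, lor_smul_right, lor_add_left, lor_smul_left, hp, lor_comm v p]; ring
  rw [← h2]
  by_cases h0 : v + lor p v • p = 0
  · rw [h0, lor_zero_left]
  · exact (lor_self_pos_of_orthogonal (by linarith) h1 h0).le

lemma abs_spatial_le {x : Vec n} (hx : lor x x ≤ 0) (hx0 : 0 ≤ x 0) (i : Fin (n + 1)) :
    |x i| ≤ x 0 := by
  refine Fin.cases (abs_of_nonneg hx0).le (fun i => ?_) i
  have : x i.succ * x i.succ ≤ ∑ i : Fin n, x i.succ * x i.succ :=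
    Finset.single_le_sum (f := fun i : Fin n => x i.succ * x i.succ)
      (fun _ _ => mul_self_nonneg _) (Finset.mem_univ i)
  simp only [lor] at hx
  exact abs_le_of_sq_le_sq (by nlinarith) hx0

/-- A quantitative form of the fact that future-directed vectors have negative products. -/
lemma zeroth_le {x p : Vec n} (hx : lor x x = -1) (hx0 : 0 < x 0) (hp : lor p p ≤ 0)
    (hp0 : 0 ≤ p 0) : p 0 ≤ 2 * x 0 * -lor x p := by
  have hcs := sum_mul_sq_le x p
  have hxn := spatial_nonneg x
  have hpn := spatial_nonneg p
  simp only [lor] at hx hp ⊢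
  set a := ∑ i : Fin n, x i.succ * x i.succ
  set c := ∑ i : Fin n, p i.succ * p i.succ
  set d := ∑ i : Fin n, x i.succ * p i.succ
  have ha : a = x 0 * x 0 - 1 := by linarith
  have hs : √a ^ 2 = a := Real.sq_sqrt hxn
  have hs0 := Real.sqrt_nonneg a
  have hd : d ≤ √a * p 0 := by
    refine le_of_sq_le_sq ?_ (by positivity)
    rw [mul_pow, hs]
    nlinarith
  have hsx : √a ≤ x 0 := Real.sqrt_le_iff.2 ⟨hx0.le, by nlinarith⟩
  have h1 : (x 0 - √a) * (x 0 + √a) = 1 := by nlinarith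
  have h2 : 1 ≤ 2 * x 0 * (x 0 - √a) := by nlinarith
  nlinarith

lemma lor_neg_of_future {x p : Vec n} (hx : lor x x = -1) (hx0 : 0 < x 0) (hp : lor p p < 0)
    (hp0 : 0 < p 0) : lor x p < 0 := by
  have := zeroth_le hx hx0 hp.le hp0.le
  by_contra h
  nlinarith [not_lt.1 h]

lemma zeroth_ne_zero {p : Vec n} (hp : lor p p < 0) : p 0 ≠ 0 := by
  intro h
  have := spatial_nonneg p
  simp only [lor, h] at hp
  linarith

lemma zeroth_pos {x p : Vec n} (hx : lor x x = -1) (hx0 : 0 < x 0) (hp : lor p p < 0)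
    (h : lor x p < 0) : 0 < p 0 := by
  rcases (zeroth_ne_zero hp).lt_or_gt with h0 | h0
  · have := lor_neg_of_future (p := -p) hx hx0 (by rwa [lor_neg_left, lor_neg_right, neg_neg])
      (by simpa using h0)
    rw [lor_neg_right] at this
    linarith
  · exact h0

/-- The orthogonal hyperplane of a timelike vector misses hyperbolic space, so the sign of `⟨x, w⟩`
is constant there. For ultraparallel `b`, `g` this is applied to whichever of `b + g`, `g - b` is
timelike. -/
lemma lor_mul_lor_pos (x y : Hyp n) {w : Vec n} (hw : lor w w < 0) :
    0 < lor x.1 w * lor y.1 w := by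
  rcases (zeroth_ne_zero hw).lt_or_gt with h0 | h0
  · have hw' : lor (-w) (-w) < 0 := by rwa [lor_neg_left, lor_neg_right, neg_neg]
    have h1 := lor_neg_of_future x.2.1 x.2.2 hw' (by simpa using h0)
    have h2 := lor_neg_of_future y.2.1 y.2.2 hw' (by simpa using h0)
    rw [lor_neg_right] at h1 h2
    nlinarith
  · exact mul_pos_of_neg_of_neg (lor_neg_of_future x.2.1 x.2.2 hw h0)
      (lor_neg_of_future y.2.1 y.2.2 hw h0)

/-- Hyperplanes passing within a bounded distance of `x` have bounded unit poles. All finiteness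
statements about base planes rest on this estimate. -/
lemma norm_le_of_unit {x g : Vec n} (hx : lor x x = -1) (hx0 : 0 < x 0) (hg : lor g g = 1) :
    ‖g‖ ≤ 2 * x 0 * (x 0 + |lor x g|) + 1 := by
  have hcs := sum_mul_sq_le x g
  have hxn := spatial_nonneg x
  have hpn := spatial_nonneg g
  have key : |g 0| ≤ 2 * x 0 * (x 0 + |lor x g|) := by
    simp only [lor] at hx hg ⊢
    set a := ∑ i : Fin n, x i.succ * x i.succ
    set c := ∑ i : Fin n, g i.succ * g i.succ
    set d := ∑ i : Fin n, x i.succ * g i.succ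
    have ha : a = x 0 * x 0 - 1 := by linarith
    have hs : √a ^ 2 = a := Real.sq_sqrt hxn
    have hs0 := Real.sqrt_nonneg a
    have hd : |d| ≤ √a * (1 + |g 0|) := by
      apply abs_le_of_sq_le_sq _ (by positivity)
      rw [mul_pow, hs]
      have : c ≤ (1 + |g 0|) ^ 2 := by
        nlinarith [abs_nonneg (g 0), abs_mul_abs_self (g 0)]
      nlinarith
    have hsx : √a ≤ x 0 := Real.sqrt_le_iff.2 ⟨hx0.le, by nlinarith⟩
    have h1 : (x 0 - √a) * (x 0 + √a) = 1 := by nlinarith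
    have h2 : 1 ≤ 2 * x 0 * (x 0 - √a) := by nlinarith
    have h3 : x 0 * |g 0| ≤ |d| + |-(x 0 * g 0) + d| := by
      calc x 0 * |g 0| = |x 0 * g 0| := by rw [abs_mul, abs_of_pos hx0]
        _ = |d - (-(x 0 * g 0) + d)| := by congr 1; ring
        _ ≤ _ := abs_sub _ _
    set t := |-(x 0 * g 0) + d|
    have h4 : |g 0| * (x 0 - √a) ≤ x 0 + t := by nlinarith
    have h5 : 0 ≤ |g 0| := abs_nonneg _
    calc |g 0| ≤ |g 0| * (2 * x 0 * (x 0 - √a)) := le_mul_of_one_le_right h5 h2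
      _ = 2 * x 0 * (|g 0| * (x 0 - √a)) := by ring
      _ ≤ _ := by gcongr
  have hge : (0:ℝ) ≤ 2 * x 0 * (x 0 + |lor x g|) := (abs_nonneg _).trans key
  refine (pi_norm_le_iff_of_nonneg (by linarith)).2 fun i => ?_
  refine le_trans ?_ (add_le_add_left key 1)
  rw [Real.norm_eq_abs]
  refine Fin.cases (by linarith) (fun i => ?_) i
  have : g i.succ * g i.succ ≤ ∑ i : Fin n, g i.succ * g i.succ :=
    Finset.single_le_sum (f := fun i : Fin n => g i.succ * g i.succ)
      (fun _ _ => mul_self_nonneg _) (Finset.mem_univ i)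
  simp only [lor] at hg
  apply abs_le_of_sq_le_sq _ (by positivity)
  nlinarith [abs_nonneg (g 0), abs_mul_abs_self (g 0)]

lemma abs_lor_le (x y : Vec n) : |lor x y| ≤ (n + 1) * (‖x‖ * ‖y‖) := by
  have h : ∀ i, |x i * y i| ≤ ‖x‖ * ‖y‖ := fun i => by
    rw [abs_mul]
    exact mul_le_mul (norm_le_pi_norm x i) (norm_le_pi_norm y i) (abs_nonneg _) (norm_nonneg _)
  calc |lor x y| ≤ |-(x 0 * y 0)| + |∑ i : Fin n, x i.succ * y i.succ| := abs_add_le _ _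
    _ ≤ ‖x‖ * ‖y‖ + ∑ i : Fin n, ‖x‖ * ‖y‖ := by
      rw [abs_neg]
      gcongr
      · exact h 0
      · exact (Finset.abs_sum_le_sum_abs _ _).trans (Finset.sum_le_sum fun i _ => h _)
    _ = _ := by simp; ring

lemma norm_le_of_causal {p : Vec n} (hp : lor p p ≤ 0) (hp0 : 0 ≤ p 0) : ‖p‖ ≤ p 0 :=
  (pi_norm_le_iff_of_nonneg hp0).2 fun i => abs_spatial_le hp hp0 i

/-! ### Normalization -/

/-- The point of hyperbolic space represented by a future-directed timelike vector. -/
def toHyp (p : Vec n) (hp : lor p p < 0) (hp0 : 0 < p 0) : Hyp n :=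
  ⟨(√(-lor p p))⁻¹ • p, by
    have h : 0 < -lor p p := by linarith
    have h1 : √(-lor p p) * √(-lor p p) = -lor p p := Real.mul_self_sqrt h.le
    have h2 : √(-lor p p) ≠ 0 := (Real.sqrt_pos.2 h).ne'
    constructor
    · rw [lor_smul_left, lor_smul_right]
      field_simp
      rw [sq, h1]; ring
    · have := Real.sqrt_pos.2 h
      simp only [Pi.smul_apply, smul_eq_mul]
      positivity⟩

lemma exists_smul_toHyp {p : Vec n} (hp : lor p p < 0) (hp0 : 0 < p 0) :
    ∃ c : ℝ, 0 < c ∧ (toHyp p hp hp0).1 = c • p :=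
  ⟨_, inv_pos.2 (Real.sqrt_pos.2 (by linarith)), rfl⟩

lemma Hyp.eq_of_smul {x y : Hyp n} {c : ℝ} (h : x.1 = c • y.1) : x = y := by
  have h1 := x.2.1
  have h2 : 0 < c := by
    have := x.2.2
    rw [h] at this
    exact pos_of_mul_pos_left this y.2.2.le
  rw [h, lor_smul_left, lor_smul_right, y.2.1] at h1
  have h3 : c = 1 := by nlinarith
  apply Subtype.ext
  rw [h, h3, one_smul]

/-- Allows perturbing a point linearly in the ambient vector space and then rescaling back to
hyperbolic space; rescaling by a positive factor does not affect homogeneous inequalities. -/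
lemma eventually_ray_mem {x : Hyp n} {U : Set (Hyp n)} (hU : U ∈ 𝓝 x) :
    ∀ᶠ p in 𝓝 x.1, ∃ y ∈ U, ∃ c : ℝ, 0 < c ∧ y.1 = c • p := by
  obtain ⟨O, hO, hOU⟩ := mem_nhds_subtype _ _ _ |>.1 hU
  have hcont : ContinuousAt (fun p : Vec n => (√(-lor p p))⁻¹ • p) x.1 := by
    have hinv : ContinuousAt (fun p : Vec n => (√(-lor p p))⁻¹) x.1 :=
      (by fun_prop : Continuous fun p : Vec n => √(-lor p p)).continuousAt.inv₀
        (by rw [x.2.1]; simp)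
    exact hinv.smul continuousAt_id
  have h1 : ∀ᶠ p in 𝓝 x.1, (√(-lor p p))⁻¹ • p ∈ O := by
    apply hcont
    simpa [x.2.1] using hO
  have h2 : ∀ᶠ p in 𝓝 x.1, lor p p < 0 :=
    (by fun_prop : Continuous fun p : Vec n => lor p p).continuousAt.eventually_lt
      continuousAt_const (by rw [x.2.1]; norm_num)
  have h3 : ∀ᶠ p in 𝓝 x.1, 0 < p 0 :=
    continuousAt_const.eventually_lt (continuous_apply (0 : Fin (n + 1))).continuousAt x.2.2
  filter_upwards [h1, h2, h3] with p hp1 hp2 hp3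
  obtain ⟨c, hc, hc'⟩ := exists_smul_toHyp hp2 hp3
  exact ⟨toHyp p hp2 hp3, hOU hp1, c, hc, hc'⟩

lemma interior_orthogonal_eq_empty {v : Vec n} (hv : v ≠ 0) {U : Set (Hyp n)} (hU : IsOpen U)
    (h : ∀ x ∈ U, lor x.1 v = 0) : U = ∅ := by
  by_contra hne
  obtain ⟨x, hx⟩ := nonempty_iff_ne_empty.2 hne
  obtain ⟨w, hw⟩ : ∃ w, lor w v ≠ 0 := by
    by_contra! hcon
    exact hv (lor_nondegenerate hcon)
  have ht : Tendsto (fun t : ℝ => x.1 + t • w) (𝓝[≠] 0) (𝓝 x.1) := by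
    have : Continuous fun t : ℝ => x.1 + t • w := by fun_prop
    simpa using (this.tendsto 0).mono_left nhdsWithin_le_nhds
  obtain ⟨t, ⟨y, hy, c, hc, hyc⟩, ht0⟩ :=
    ((ht.eventually (eventually_ray_mem (hU.mem_nhds hx))).and self_mem_nhdsWithin).exists
  have := h y hy
  rw [hyc, lor_smul_left, lor_add_left, lor_smul_left, h x hx, zero_add] at this
  rcases mul_eq_zero.1 this with h1 | h1
  · exact hc.ne' h1
  · rcases mul_eq_zero.1 h1 with h2 | h2
    · exact ht0 h2
    · exact hw h2

/-- The form in which separation by a hyperplane is used: two opposite weak inequalities leave only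
the hyperplane orthogonal to `v`, which has no interior. -/
lemma disjoint_interior_of_orthogonal {v : Vec n} (hv : v ≠ 0) {C D : Set (Hyp n)}
    (h : ∀ x ∈ C, x ∈ D → lor x.1 v = 0) : Disjoint (interior C) (interior D) := by
  rw [disjoint_iff_inter_eq_empty]
  exact interior_orthogonal_eq_empty hv (isOpen_interior.inter isOpen_interior) fun x hx =>
    h x (interior_subset hx.1) (interior_subset hx.2)

end Lorentz

/-! ### Polyhedral cones -/

section Cones

variable {n : ℕ} {S T : Set (Vec n)} {A B x v : Vec n}

lemma halfspaceCone_anti (h : T ⊆ S) : halfspaceCone S ⊆ halfspaceCone T :=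
  fun _ hx b hb => hx b (h hb)

lemma add_mem_halfspaceCone (hx : x ∈ halfspaceCone S) (hv : v ∈ halfspaceCone S) :
    x + v ∈ halfspaceCone S := fun b hb => by
  rw [lor_add_left]; exact add_nonpos (hx b hb) (hv b hb)

lemma smul_mem_halfspaceCone (hx : x ∈ halfspaceCone S) {c : ℝ} (hc : 0 ≤ c) :
    c • x ∈ halfspaceCone S := fun b hb => by
  rw [lor_smul_left]; exact mul_nonpos_of_nonneg_of_nonpos hc (hx b hb)

/-- The vectors in the cone generated by `S`, characterized by duality. -/
def dualCone (S : Set (Vec n)) : Set (Vec n) := {x | ∀ A ∈ halfspaceCone S, lor x A ≤ 0}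

/-- The elements of `S` whose polar hyperplanes pass through `A`. -/
def tight (S : Set (Vec n)) (A : Vec n) : Set (Vec n) := {b ∈ S | lor A b = 0}

lemma tight_subset : tight S A ⊆ S := fun _ hb => hb.1

lemma dualCone_mono (h : T ⊆ S) : dualCone T ⊆ dualCone S :=
  fun _ hx A hA => hx A (halfspaceCone_anti h hA)

/-- A compact cross-section of the cone. -/
def coneSlice (hS : S.Finite) : Set (Vec n) :=
  {A | A ∈ halfspaceCone S ∧ ∑ b ∈ hS.toFinset, lor A b = -1}

lemma sum_lor_nonpos (hS : S.Finite) (hA : A ∈ halfspaceCone S) :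
    ∑ b ∈ hS.toFinset, lor A b ≤ 0 :=
  Finset.sum_nonpos fun b hb => hA b (hS.mem_toFinset.1 hb)

lemma sum_lor_neg (hS : S.Finite) (hspan : Submodule.span ℝ S = ⊤) (hA : A ∈ halfspaceCone S)
    (hA0 : A ≠ 0) : ∑ b ∈ hS.toFinset, lor A b < 0 := by
  refine (sum_lor_nonpos hS hA).lt_of_ne fun h => hA0 (eq_zero_of_span hspan fun b hb => ?_)
  exact (Finset.sum_eq_zero_iff_of_nonpos fun b hb => hA b (hS.mem_toFinset.1 hb)).1 h b
    (hS.mem_toFinset.2 hb)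

lemma isClosed_halfspaceCone (S : Set (Vec n)) : IsClosed (halfspaceCone S) := by
  have : halfspaceCone S = ⋂ b ∈ S, {x | lor x b ≤ 0} := by ext; simp [halfspaceCone]
  rw [this]
  exact isClosed_biInter fun b _ => isClosed_le (by fun_prop) continuous_const

lemma isClosed_dualCone (S : Set (Vec n)) : IsClosed (dualCone S) := by
  have : dualCone S = ⋂ b ∈ halfspaceCone S, {x | lor x b ≤ 0} := by ext; simp [dualCone]
  rw [this]
  exact isClosed_biInter fun b _ => isClosed_le (by fun_prop) continuous_const

/-- On the slice every `⟨A, b⟩` lies in `[-1, 0]`, and since `S` spans, `A ↦ (⟨A, b⟩)_b` is a closed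
embedding. -/
lemma isCompact_coneSlice (hS : S.Finite) (hspan : Submodule.span ℝ S = ⊤) :
    IsCompact (coneSlice hS) := by
  have := hS.fintype
  let Φ : Vec n →ₗ[ℝ] (S → ℝ) := LinearMap.pi fun b => lorLin b.1
  have hΦ : LinearMap.ker Φ = ⊥ := by
    rw [LinearMap.ker_eq_bot']
    intro v hv
    exact eq_zero_of_span hspan fun b hb => congrFun hv ⟨b, hb⟩
  have hemb := LinearMap.isClosedEmbedding_of_injective hΦ
  have hK : IsCompact (Set.pi univ fun _ : S => Icc (-1 : ℝ) 0) :=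
    isCompact_univ_pi fun _ => isCompact_Icc
  refine (hemb.isCompact_preimage hK).of_isClosed_subset ?_ ?_
  · exact (isClosed_halfspaceCone S).inter (isClosed_eq
      (continuous_finsetSum _ fun b _ => by fun_prop) continuous_const)
  · rintro A ⟨hA, hsum⟩ b -
    refine ⟨?_, hA b b.2⟩
    change -1 ≤ lor A b
    rw [← hsum]
    have := Finset.single_le_sum (f := fun b => -lor A b) (s := hS.toFinset)
      (fun c hc => neg_nonneg.2 (hA c (hS.mem_toFinset.1 hc))) (hS.mem_toFinset.2 b.2)
    rw [Finset.sum_neg_distrib] at this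
    linarith

lemma exists_smul_mem_coneSlice (hS : S.Finite) (hspan : Submodule.span ℝ S = ⊤)
    (hA : A ∈ halfspaceCone S) (hA0 : A ≠ 0) : ∃ c : ℝ, 0 < c ∧ c • A ∈ coneSlice hS := by
  have h := sum_lor_neg hS hspan hA hA0
  refine ⟨(-∑ b ∈ hS.toFinset, lor A b)⁻¹, inv_pos.2 (by linarith), ?_, ?_⟩
  · exact smul_mem_halfspaceCone hA (inv_nonneg.2 (by linarith))
  · simp only [lor_smul_left, ← Finset.mul_sum]
    rw [inv_neg, neg_mul, inv_mul_cancel₀ h.ne]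

lemma isProjVertex_of_mem_extremePoints (hS : S.Finite) (hspan : Submodule.span ℝ S = ⊤)
    (hA : A ∈ (coneSlice hS).extremePoints ℝ) : IsProjVertex S A := by
  obtain ⟨hmem, hext⟩ := hA
  refine ⟨?_, hmem.1, fun x hx y hy hxy => ?_⟩
  · rintro rfl
    simpa [lor_zero_left] using hmem.2
  by_cases hx0 : x = 0
  · exact ⟨0, by simp [hx0]⟩
  by_cases hy0 : y = 0
  · exact ⟨1, by rw [← hxy, hy0]; simp⟩
  have hsx := sum_lor_neg hS hspan hx hx0
  have hsy := sum_lor_neg hS hspan hy hy0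
  have hs : ∑ b ∈ hS.toFinset, lor x b + ∑ b ∈ hS.toFinset, lor y b = -1 := by
    rw [← Finset.sum_add_distrib, ← hmem.2, ← hxy]
    simp only [lor_add_left]
  set s := ∑ b ∈ hS.toFinset, lor x b with hsdef
  set t := ∑ b ∈ hS.toFinset, lor y b with htdef
  have hxs : (-s)⁻¹ • x ∈ coneSlice hS := by
    refine ⟨smul_mem_halfspaceCone hx (inv_nonneg.2 (by linarith)), ?_⟩
    simp only [lor_smul_left, ← Finset.mul_sum, ← hsdef]
    rw [inv_neg, neg_mul, inv_mul_cancel₀ hsx.ne]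
  have hys : (-t)⁻¹ • y ∈ coneSlice hS := by
    refine ⟨smul_mem_halfspaceCone hy (inv_nonneg.2 (by linarith)), ?_⟩
    simp only [lor_smul_left, ← Finset.mul_sum, ← htdef]
    rw [inv_neg, neg_mul, inv_mul_cancel₀ hsy.ne]
  have hseg : A ∈ openSegment ℝ ((-s)⁻¹ • x) ((-t)⁻¹ • y) := by
    refine ⟨-s, -t, by linarith, by linarith, by linarith, ?_⟩
    rw [smul_smul, smul_smul, mul_inv_cancel₀ (by linarith), mul_inv_cancel₀ (by linarith),
      one_smul, one_smul, hxy]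
  have := hext hxs hys hseg
  refine ⟨-s, ?_⟩
  rw [← this, smul_smul, mul_inv_cancel₀ (by linarith), one_smul]

/-- The cone is generated by its extreme rays. -/
lemma mem_dualCone_of_vertices (hS : S.Finite) (hspan : Submodule.span ℝ S = ⊤)
    (h : ∀ A, IsProjVertex S A → lor x A ≤ 0) : x ∈ dualCone S := by
  have hcomp := isCompact_coneSlice hS hspan
  have hconv : Convex ℝ (coneSlice hS) := by
    rintro A ⟨hA, hA1⟩ B ⟨hB, hB1⟩ a b ha hb hab
    refine ⟨add_mem_halfspaceCone (smul_mem_halfspaceCone hA ha) (smul_mem_halfspaceCone hB hb), ?_⟩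
    simp only [lor_add_left, lor_smul_left, Finset.sum_add_distrib, ← Finset.mul_sum, hA1, hB1]
    linarith
  -- By Krein–Milman, an inequality that holds at the extreme points of the compact slice holds on
  -- the whole slice, and by scaling on the cone.
  have hKM := closure_convexHull_extremePoints hcomp hconv
  have hsub : coneSlice hS ⊆ {A | lor x A ≤ 0} := by
    rw [← hKM]
    refine closure_minimal (convexHull_min (fun A hA => h A
      (isProjVertex_of_mem_extremePoints hS hspan hA)) ?_)
      (isClosed_le (by fun_prop) continuous_const)
    intro A hA B hB a b ha hb _
    simp only [mem_ofPred_eq, lor_add_right, lor_smul_right] at *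
    nlinarith
  intro A hA
  by_cases hA0 : A = 0
  · rw [hA0, lor_zero_right]
  · obtain ⟨c, hc, hcA⟩ := exists_smul_mem_coneSlice hS hspan hA hA0
    have : lor x (c • A) ≤ 0 := hsub hcA
    rw [lor_smul_right] at this
    exact nonpos_of_mul_nonpos_right this hc

/-- A vector that satisfies the constraints tight at `A` points into the cone at `A`. -/
lemma exists_smul_add_mem (hS : S.Finite) (hA : A ∈ halfspaceCone S)
    (hv : ∀ b ∈ tight S A, lor v b ≤ 0) : ∃ M : ℝ, 0 < M ∧ v + M • A ∈ halfspaceCone S := by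
  have h : ∀ b ∈ S, ∀ᶠ M : ℝ in atTop, lor (v + M • A) b ≤ 0 := by
    intro b hb
    simp only [lor_add_left, lor_smul_left]
    rcases (hA b hb).lt_or_eq with h0 | h0
    · filter_upwards [eventually_ge_atTop (lor v b / -lor A b)] with M hM
      rw [div_le_iff₀ (by linarith)] at hM
      linarith
    · filter_upwards with M
      rw [h0, mul_zero, add_zero]
      exact hv b ⟨hb, h0⟩
  obtain ⟨M, hM, hM0⟩ := (((eventually_all_finite hS).2 h).and (eventually_gt_atTop 0)).exists
  exact ⟨M, hM0, hM⟩

/-- An extreme ray is determined by its tight constraints: for large `M` and `N` both `v + M • A`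
and `-v + N • A` are in the cone, and their sum is a multiple of `A`. -/
lemma IsProjVertex.exists_eq_smul (hS : S.Finite) (hA : IsProjVertex S A)
    (hv : ∀ b ∈ tight S A, lor v b = 0) : ∃ c : ℝ, v = c • A := by
  obtain ⟨M, hM, h1⟩ := exists_smul_add_mem hS hA.2.1 fun b hb => (hv b hb).le
  obtain ⟨N, hN, h2⟩ := exists_smul_add_mem (v := -v) hS hA.2.1 fun b hb => by
    rw [lor_neg_left, hv b hb, neg_zero]
  obtain ⟨c, hc⟩ := hA.2.2 _ (smul_mem_halfspaceCone h1 (inv_nonneg.2 (add_pos hM hN).le)) _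
    (smul_mem_halfspaceCone h2 (inv_nonneg.2 (add_pos hM hN).le)) (by
      rw [← smul_add, show v + M • A + (-v + N • A) = (M + N) • A by rw [add_smul]; abel,
        inv_smul_smul₀ (add_pos hM hN).ne'])
  refine ⟨(M + N) * c - M, ?_⟩
  rw [inv_smul_eq_iff₀ (add_pos hM hN).ne'] at hc
  rw [sub_smul, mul_smul, ← hc, add_sub_cancel_right]

/-- There are finitely many extreme rays. -/
lemma finite_projVertex (hS : S.Finite) :
    {A | IsProjVertex S A ∧ A ∈ coneSlice hS}.Finite := by
  -- On the slice, an extreme point can be recovered from the subset of `S` tight at it.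
  refine Finite.of_injOn (f := tight S) (t := 𝒫 S) (fun A _ => tight_subset) ?_ hS.finite_subsets
  rintro A ⟨hA, hA1⟩ B ⟨hB, hB1⟩ hAB
  obtain ⟨c, hc⟩ := hB.exists_eq_smul hS (v := A) fun b hb => (hAB ▸ hb : b ∈ tight S A).2
  have h1 := hA1.2
  simp only [hc, lor_smul_left, ← Finset.mul_sum, hB1.2] at h1
  rw [hc, show c = 1 by linarith, one_smul]

lemma IsProjVertex.smul (hA : IsProjVertex S A) {c : ℝ} (hc : 0 < c) : IsProjVertex S (c • A) := by
  refine ⟨smul_ne_zero hc.ne' hA.1, smul_mem_halfspaceCone hA.2.1 hc.le, fun x hx y hy hxy => ?_⟩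
  obtain ⟨d, hd⟩ := hA.2.2 _ (smul_mem_halfspaceCone hx (inv_nonneg.2 hc.le)) _
    (smul_mem_halfspaceCone hy (inv_nonneg.2 hc.le)) (by rw [← smul_add, hxy, inv_smul_smul₀ hc.ne'])
  refine ⟨d, ?_⟩
  rw [inv_smul_eq_iff₀ hc.ne'] at hd
  rw [hd, smul_comm]

end Cones

/-! ### Configurations of poles -/

/-- Finitely many poles of pairwise ultraparallel hyperplanes which bound a common region with the
inner point `P` and are in general position. -/
structure PoleConfig {n : ℕ} (P : Hyp n) (S : Set (Vec n)) : Prop where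
  finite : S.Finite
  span : Submodule.span ℝ S = ⊤
  unit : ∀ b ∈ S, lor b b = 1
  lt : ∀ b ∈ S, ∀ b' ∈ S, b ≠ b' → lor b b' < -1
  neg : ∀ b ∈ S, lor P.1 b < 0

section PoleConfig

variable {n : ℕ} {P : Hyp n} {S T : Set (Vec n)} {A B v : Vec n}

lemma PoleConfig.subset (hS : PoleConfig P S) (hT : T ⊆ S) (hspan : Submodule.span ℝ T = ⊤) :
    PoleConfig P T :=
  ⟨hS.finite.subset hT, hspan, fun b hb => hS.unit b (hT hb),
    fun b hb b' hb' => hS.lt b (hT hb) b' (hT hb'), fun b hb => hS.neg b (hT hb)⟩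

/-- Ultraparallel hyperplanes meet only in outer points, because `b + b'` is timelike. -/
lemma lor_self_pos_of_orthogonal_pair {b b' : Vec n} (hb : lor b b = 1) (hb' : lor b' b' = 1)
    (h : lor b b' < -1) (h1 : lor v b = 0) (h2 : lor v b' = 0) (hv : v ≠ 0) : 0 < lor v v := by
  refine lor_self_pos_of_orthogonal (p := b + b') ?_ ?_ hv
  · simp only [lor_add_left, lor_add_right, hb, hb', lor_comm b' b]; linarith
  · rw [lor_comm, lor_add_right, h1, h2, add_zero]

lemma one_lt_finrank_ker (hn : 1 < n) (b : Vec n) :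
    1 < Module.finrank ℝ (LinearMap.ker (lorLin b)) := by
  have h1 := (lorLin b).finrank_range_add_finrank_ker
  have h2 : Module.finrank ℝ (LinearMap.range (lorLin b)) ≤ 1 := by
    simpa using Submodule.finrank_le (LinearMap.range (lorLin b))
  rw [Module.finrank_fin_fun] at h1
  omega

/-- A point which is the only common point of hyperplanes of the configuration is outer. -/
lemma PoleConfig.outer (hn : 1 < n) (hS : PoleConfig P S) (hA : A ≠ 0)
    (h : ∀ x : Vec n, (∀ b ∈ tight S A, lor x b = 0) → ∃ c : ℝ, x = c • A) : 0 < lor A A := by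
  obtain ⟨b, hb, b', hb', hne⟩ : ∃ b ∈ tight S A, ∃ b' ∈ tight S A, b ≠ b' := by
    by_contra! hcon
    obtain ⟨b, hb⟩ : ∃ b, ∀ b' ∈ tight S A, b' = b := by
      by_cases hemp : (tight S A).Nonempty
      · obtain ⟨b, hb⟩ := hemp
        exact ⟨b, fun b' hb' => hcon b' hb' b hb⟩
      · exact ⟨0, fun b' hb' => (hemp ⟨b', hb'⟩).elim⟩
    have hle : LinearMap.ker (lorLin b) ≤ Submodule.span ℝ {A} := by
      intro x hx
      obtain ⟨c, hc⟩ := h x fun b' hb' => by rw [hb b' hb']; exact hx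
      exact Submodule.mem_span_singleton.2 ⟨c, hc.symm⟩
    have h1 := Submodule.finrank_mono hle
    have h2 := finrank_span_le_card (R := ℝ) ({A} : Set (Vec n))
    have h3 := one_lt_finrank_ker hn b
    simp at h2
    omega
  exact lor_self_pos_of_orthogonal_pair (hS.unit b hb.1) (hS.unit b' hb'.1)
    (hS.lt b hb.1 b' hb'.1 hne) hb.2 hb'.2 hA

/-! ### Truncated polytopes as intersections of a cone with its dual -/

/-- All vertices are outer, so truncation imposes `⟨x, A⟩ ≤ 0` at every extreme ray `A`, hence on
the whole cone. -/
lemma PoleConfig.cutPolytope_eq (hn : 1 < n) (hS : PoleConfig P S) :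
    cutPolytope S = {x | x.1 ∈ halfspaceCone S ∧ x.1 ∈ dualCone S} := by
  ext x
  refine and_congr_right fun _ => ⟨fun h => ?_, fun h A hA _ => h A hA.2.1⟩
  exact mem_dualCone_of_vertices hS.finite hS.span fun A hA =>
    h A hA (hS.outer hn hA.1 fun v hv => hA.exists_eq_smul hS.finite hv)

lemma PoleConfig.mem_halfspaceCone (hS : PoleConfig P S) (hT : T ⊆ S) {b : Vec n} (hb : b ∈ S)
    (hbT : b ∉ T) : b ∈ halfspaceCone T := fun t ht =>
  (hS.lt b hb t (hT ht) (by rintro rfl; exact hbT ht)).le.trans (by norm_num)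

/-- Dropping the half-spaces of `S \ T` costs nothing: each such `b` has negative products with all
of `T`, so `⟨x, b⟩ ≤ 0` is among the conditions defining `dualCone T`. Cutting thereby becomes a
question about generated cones only. -/
lemma PoleConfig.cutPolytope_subset (hn : 1 < n) (hS : PoleConfig P S) (hT : T ⊆ S)
    (hspan : Submodule.span ℝ T = ⊤) :
    cutPolytope T = cutPolytope S ∩ {x | x.1 ∈ dualCone T} := by
  rw [hS.cutPolytope_eq hn, (hS.subset hT hspan).cutPolytope_eq hn]
  ext x
  constructor
  · rintro ⟨h1, h2⟩
    refine ⟨⟨fun b hb => ?_, dualCone_mono hT h2⟩, h2⟩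
    by_cases hbT : b ∈ T
    · exact h1 b hbT
    · exact h2 b (hS.mem_halfspaceCone hT hb hbT)
  · rintro ⟨⟨h1, -⟩, h2⟩
    exact ⟨halfspaceCone_anti hT h1, h2⟩

/-- A facet of a subconfiguration which is not a facet of the configuration gives a cutting
point. -/
lemma PoleConfig.isCuttingPoint (hn : 1 < n) (hS : PoleConfig P S) (hT : T ⊆ S)
    (hA : A ≠ 0) (h : ∀ x : Vec n, (∀ b ∈ tight T A, lor x b = 0) → ∃ c : ℝ, x = c • A)
    (hpos : ∃ b ∈ S, 0 < lor A b) (hneg : ∃ b ∈ S, lor A b < 0) : IsCuttingPoint S A := by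
  have h' : ∀ x : Vec n, (∀ b ∈ tight S A, lor x b = 0) → ∃ c : ℝ, x = c • A :=
    fun x hx => h x fun b hb => hx b ⟨hT hb.1, hb.2⟩
  refine ⟨hS.outer hn hA h', fun x hx => h' x fun b hb => hx b hb.1 hb.2, ?_⟩
  rintro ⟨A', hA', hAA'⟩
  obtain ⟨c, hc⟩ := h' A' fun b hb => hAA' b hb.1 hb.2
  obtain ⟨b, hb, hb0⟩ := hpos
  obtain ⟨b', hb', hb'0⟩ := hneg
  have h1 := hA'.2.1 b hb
  have h2 := hA'.2.1 b' hb'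
  have hc0 : c ≠ 0 := by
    rintro rfl
    exact hA'.1 (by rw [hc, zero_smul])
  rw [hc, lor_smul_left] at h1 h2
  rcases hc0.lt_or_gt with h0 | h0 <;> nlinarith

lemma exists_lor_neg (hspan : Submodule.span ℝ S = ⊤) (hA : A ∈ halfspaceCone S) (hA0 : A ≠ 0) :
    ∃ b ∈ S, lor A b < 0 := by
  by_contra! h
  exact hA0 (eq_zero_of_span hspan fun b hb => le_antisymm (hA b hb) (h b hb))

/-- The extreme rays `A` of `halfspaceCone T` are the facet normals of the cone generated by `T`.
Those in `halfspaceCone S` give conditions already valid on `D(S)`; the others have poles of `S`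
strictly on both sides and so are cutting points. -/
lemma PoleConfig.walls (hn : 1 < n) (hS : PoleConfig P S) (hT : T ⊆ S)
    (hspan : Submodule.span ℝ T = ⊤) :
    ∃ 𝒜 : Set (Vec n), (∀ A ∈ 𝒜, IsCuttingPoint S A) ∧
      cutPolytope T = cutPolytope S ∩ {x | ∀ A ∈ 𝒜, lor x.1 A ≤ 0} := by
  have hTc := hS.subset hT hspan
  refine ⟨{A | IsProjVertex T A ∧ A ∉ halfspaceCone S}, ?_, ?_⟩
  · rintro A ⟨hA, hAS⟩
    refine hS.isCuttingPoint hn hT hA.1 (fun x => hA.exists_eq_smul hTc.finite) ?_ ?_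
    · simpa [halfspaceCone] using hAS
    · obtain ⟨b, hb, h⟩ := exists_lor_neg hspan hA.2.1 hA.1
      exact ⟨b, hT hb, h⟩
  · rw [hS.cutPolytope_subset hn hT hspan]
    ext x
    refine and_congr_right fun hx => ⟨fun h A hA => h A hA.1.2.1, fun h => ?_⟩
    rw [hS.cutPolytope_eq hn] at hx
    refine mem_dualCone_of_vertices hTc.finite hspan fun A hA => ?_
    by_cases hAS : A ∈ halfspaceCone S
    · exact hx.2 A hAS
    · exact h A ⟨hA, hAS⟩

/-! ### Compactness and interior of the truncated polytopes -/

/-- Testing `x` against itself gives `⟨x, x⟩ ≤ 0`. If `x` were null, it would be orthogonal to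
everything orthogonal to its tight poles. Two tight poles make `x` spacelike; with at most one, `x`
is a multiple of a pole orthogonal to it, hence zero. -/
lemma PoleConfig.timelike (hS : PoleConfig P S) {x : Vec n} (hx : x ∈ halfspaceCone S)
    (hx' : x ∈ dualCone S) (hx0 : x ≠ 0) : lor x x < 0 := by
  refine (hx' x hx).lt_of_ne fun h0 => ?_
  have key : ∀ v, (∀ b ∈ tight S x, lor v b = 0) → lor x v ≤ 0 := by
    intro v hv
    obtain ⟨M, -, hM⟩ := exists_smul_add_mem hS.finite hx fun b hb => (hv b hb).le
    simpa [lor_add_right, lor_smul_right, h0] using hx' _ hM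
  have key' : ∀ v, (∀ b ∈ tight S x, lor v b = 0) → lor v x = 0 := by
    intro v hv
    have h1 := key v hv
    have h2 := key (-v) fun b hb => by rw [lor_neg_left, hv b hb, neg_zero]
    rw [lor_neg_right] at h2
    rw [lor_comm]
    linarith
  by_cases h : ∃ b ∈ tight S x, ∃ b' ∈ tight S x, b ≠ b'
  · obtain ⟨b, hb, b', hb', hne⟩ := h
    have := lor_self_pos_of_orthogonal_pair (hS.unit b hb.1) (hS.unit b' hb'.1)
      (hS.lt b hb.1 b' hb'.1 hne) hb.2 hb'.2 hx0
    linarith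
  · push Not at h
    apply hx0
    apply lor_nondegenerate
    intro w
    by_cases hemp : (tight S x).Nonempty
    · obtain ⟨b, hb⟩ := hemp
      have := key' (w - lor w b • b) fun b' hb' => by
        rw [h b' hb' b hb, lor_sub_left, lor_smul_left, hS.unit b hb.1, mul_one, sub_self]
      rwa [lor_sub_left, lor_smul_left, lor_comm b x, hb.2, mul_zero, sub_zero] at this
    · exact key' w fun b hb => (hemp ⟨b, hb⟩).elim

/-- Normalizing by `⟨P, x⟩ = -1` instead of `⟨x, x⟩ = -1` gives a closed bounded set. By
`PoleConfig.timelike` it stays off the light cone, so rescaling back to hyperbolic space is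
continuous on it. -/
lemma PoleConfig.isCompact_cutPolytope (hn : 1 < n) (hS : PoleConfig P S) :
    IsCompact (cutPolytope S) := by
  let K : Set (Vec n) := {x | x ∈ halfspaceCone S ∧ x ∈ dualCone S ∧ lor P.1 x = -1}
  have hne : ∀ x ∈ K, x ≠ 0 := by
    rintro x hx rfl
    simpa [lor_zero_right] using hx.2.2
  have htl : ∀ x ∈ K, lor x x < 0 := fun x hx => hS.timelike hx.1 hx.2.1 (hne x hx)
  have hpos : ∀ x ∈ K, 0 < x 0 := fun x hx =>
    zeroth_pos P.2.1 P.2.2 (htl x hx) (by rw [hx.2.2]; norm_num)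
  have hK : IsCompact K := by
    refine Metric.isCompact_of_isClosed_isBounded ?_ ?_
    · exact (isClosed_halfspaceCone S).inter ((isClosed_dualCone S).inter
        (isClosed_eq (by fun_prop) continuous_const))
    · refine isBounded_iff_forall_norm_le.2 ⟨2 * P.1 0, fun x hx => ?_⟩
      have h1 := norm_le_of_causal (htl x hx).le (hpos x hx).le
      have h2 := zeroth_le P.2.1 P.2.2 (htl x hx).le (hpos x hx).le
      rw [hx.2.2] at h2
      linarith
  rw [Subtype.isCompact_iff]
  have himg : Subtype.val '' cutPolytope S = (fun x : Vec n => (√(-lor x x))⁻¹ • x) '' K := by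
    ext x
    constructor
    · rintro ⟨x, hx, rfl⟩
      rw [hS.cutPolytope_eq hn] at hx
      have hPx : lor P.1 x.1 < 0 := lor_neg_of_future P.2.1 P.2.2 (by rw [x.2.1]; norm_num) x.2.2
      have hc : 0 < (-lor P.1 x.1)⁻¹ := inv_pos.2 (by linarith)
      refine ⟨(-lor P.1 x.1)⁻¹ • x.1, ⟨smul_mem_halfspaceCone hx.1 hc.le, fun A hA => ?_, ?_⟩, ?_⟩
      · rw [lor_smul_left]
        exact mul_nonpos_of_nonneg_of_nonpos hc.le (hx.2 A hA)
      · rw [lor_smul_right, inv_neg, neg_mul, inv_mul_cancel₀ hPx.ne]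
      · simp only [lor_smul_left, lor_smul_right, x.2.1]
        rw [smul_smul, show -((-lor P.1 x.1)⁻¹ * ((-lor P.1 x.1)⁻¹ * -1)) = (-lor P.1 x.1)⁻¹ ^ 2
          by ring, Real.sqrt_sq hc.le, inv_mul_cancel₀ hc.ne', one_smul]
    · rintro ⟨x, hx, rfl⟩
      refine ⟨toHyp x (htl x hx) (hpos x hx), ?_, rfl⟩
      obtain ⟨c, hc, hcx⟩ := exists_smul_toHyp (htl x hx) (hpos x hx)
      rw [hS.cutPolytope_eq hn]
      refine ⟨?_, fun A hA => ?_⟩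
      · rw [hcx]
        exact smul_mem_halfspaceCone hx.1 hc.le
      · rw [hcx, lor_smul_left]
        exact mul_nonpos_of_nonneg_of_nonpos hc.le (hx.2.1 A hA)
  rw [himg]
  have hinv : ContinuousOn (fun x : Vec n => (√(-lor x x))⁻¹) K :=
    (by fun_prop : Continuous fun x : Vec n => √(-lor x x)).continuousOn.inv₀ fun x hx =>
      (Real.sqrt_pos.2 (by linarith [htl x hx])).ne'
  exact hK.image_of_continuousOn (hinv.smul continuousOn_id)

lemma PoleConfig.nontrivial (hn : 1 < n) (hS : PoleConfig P S) : S.Nontrivial := by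
  by_contra h
  rw [not_nontrivial_iff] at h
  obtain ⟨b, hb⟩ : ∃ b, ∀ b' ∈ S, b' = b := by
    rcases h.eq_empty_or_singleton with h | ⟨b, h⟩
    · exact ⟨0, by simp [h]⟩
    · exact ⟨b, by simp [h]⟩
  have h3 := one_lt_finrank_ker hn b
  have : LinearMap.ker (lorLin b) = ⊥ := by
    rw [Submodule.eq_bot_iff]
    exact fun x hx => eq_zero_of_span hS.span fun b' hb' => by rw [hb b' hb']; exact hx
  rw [this] at h3
  simp at h3

/-- The sum `s` of the poles satisfies all conditions strictly. In `⟨s, b⟩` the term `⟨b, b⟩ = 1` is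
outweighed by any single other pole, and `⟨s, A⟩ = -1` on the slice, whose compactness makes the
infinitely many dual conditions open. -/
lemma PoleConfig.nonempty_interior (hn : 1 < n) (hS : PoleConfig P S) :
    (interior (cutPolytope S)).Nonempty := by
  set s := ∑ b ∈ hS.finite.toFinset, b with hs
  have h1 : ∀ b ∈ S, lor s b < 0 := by
    intro b hb
    obtain ⟨b', hb', hne⟩ := (hS.nontrivial hn).exists_ne b
    have hbf := hS.finite.mem_toFinset.2 hb
    have hbf' : b' ∈ hS.finite.toFinset.erase b :=
      Finset.mem_erase.2 ⟨hne, hS.finite.mem_toFinset.2 hb'⟩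
    rw [hs, lor_sum_left, ← Finset.add_sum_erase _ _ hbf, hS.unit b hb,
      ← Finset.add_sum_erase _ _ hbf']
    have h2 : ∑ x ∈ (hS.finite.toFinset.erase b).erase b', lor x b ≤ 0 := by
      refine Finset.sum_nonpos fun c hc => ?_
      simp only [Finset.mem_erase, Finite.mem_toFinset] at hc
      linarith [hS.lt c hc.2.2 b hb hc.2.1]
    linarith [hS.lt b' hb' b hb hne]
  have h2 : ∀ A ∈ coneSlice hS.finite, lor s A < 0 := by
    rintro A ⟨-, hA⟩
    rw [lor_comm, hs, lor_sum_right, hA]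
    norm_num
  have hss : lor s s < 0 := by
    conv_lhs => rw [hs, lor_sum_left]
    refine Finset.sum_neg (fun b hb => ?_) ?_
    · rw [lor_comm]
      exact h1 b (hS.finite.mem_toFinset.1 hb)
    · obtain ⟨b, hb⟩ := (hS.nontrivial hn).nonempty
      exact ⟨b, hS.finite.mem_toFinset.2 hb⟩
  have hPs : lor P.1 s < 0 := by
    rw [hs, lor_sum_right]
    refine Finset.sum_neg (fun b hb => hS.neg b (hS.finite.mem_toFinset.1 hb)) ?_
    obtain ⟨b, hb⟩ := (hS.nontrivial hn).nonempty
    exact ⟨b, hS.finite.mem_toFinset.2 hb⟩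
  have hs0 := zeroth_pos P.2.1 P.2.2 hss hPs
  obtain ⟨c, hc, hcs⟩ := exists_smul_toHyp hss hs0
  refine ⟨toHyp s hss hs0, mem_interior_iff_mem_nhds.2 ?_⟩
  have e1 : ∀ᶠ x in 𝓝 (toHyp s hss hs0), ∀ b ∈ S, lor x.1 b < 0 := by
    rw [eventually_all_finite hS.finite]
    intro b hb
    refine (by fun_prop : Continuous fun x : Hyp n => lor x.1 b).continuousAt.eventually_lt
      continuousAt_const ?_
    rw [hcs, lor_smul_left]
    exact mul_neg_of_pos_of_neg hc (h1 b hb)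
  have e2 : ∀ᶠ x in 𝓝 (toHyp s hss hs0), ∀ A ∈ coneSlice hS.finite, lor x.1 A < 0 := by
    refine (isCompact_coneSlice hS.finite hS.span).eventually_forall_of_forall_eventually ?_
    intro A hA
    refine (by fun_prop : Continuous fun z : Hyp n × Vec n => lor z.1.1 z.2).continuousAt.eventually_lt
      continuousAt_const ?_
    change lor (toHyp s hss hs0).1 A < 0
    rw [hcs, lor_smul_left]
    exact mul_neg_of_pos_of_neg hc (h2 A hA)
  filter_upwards [e1, e2] with x hx1 hx2
  rw [hS.cutPolytope_eq hn]
  refine ⟨fun b hb => (hx1 b hb).le, fun A hA => ?_⟩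
  by_cases hA0 : A = 0
  · rw [hA0, lor_zero_right]
  · obtain ⟨d, hd, hdA⟩ := exists_smul_mem_coneSlice hS.finite hS.span hA hA0
    have := hx2 _ hdA
    rw [lor_smul_right] at this
    exact (neg_of_mul_neg_right this hd.le).le

end PoleConfig

/-! ### Cutting -/

section Cutting

variable {n : ℕ} {P : Hyp n} {S T : Set (Vec n)} {A B v b₀ : Vec n}

lemma mem_halfspaceCone_of_diff (hA : A ∈ halfspaceCone (S \ {b₀})) (h : lor A b₀ ≤ 0) :
    A ∈ halfspaceCone S := fun b hb => by
  by_cases hbb : b = b₀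
  · rwa [hbb]
  · exact hA b ⟨hb, hbb⟩

/-- If `x` is outside the cone of `S \ {b₀}`, move it in the direction `-b₀` until it enters that
cone. It does so through a facet, with normal `A`, visible from `b₀`, so `x` is in the cone over
that facet with apex `b₀`. -/
lemma PoleConfig.mem_dualCone_diff_or (hS : PoleConfig P S)
    (hspan : Submodule.span ℝ (S \ {b₀}) = ⊤) {x : Vec n} (hx : x ∈ dualCone S) :
    x ∈ dualCone (S \ {b₀}) ∨ ∃ A, IsProjVertex (S \ {b₀}) A ∧ 0 < lor A b₀ ∧
      x ∈ dualCone (insert b₀ (tight (S \ {b₀}) A)) := by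
  have hfin : (S \ {b₀}).Finite := hS.finite.subset sdiff_subset
  by_cases hall : ∀ A, IsProjVertex (S \ {b₀}) A → lor x A ≤ 0
  · exact Or.inl (mem_dualCone_of_vertices hfin hspan hall)
  right
  push Not at hall
  obtain ⟨A₁, hA₁, hxA₁⟩ := hall
  have hA₁b : 0 < lor A₁ b₀ := by
    by_contra! h
    exact hxA₁.not_ge (hx A₁ (mem_halfspaceCone_of_diff hA₁.2.1 h))
  let V : Set (Vec n) := {A | (IsProjVertex (S \ {b₀}) A ∧ A ∈ coneSlice hfin) ∧ 0 < lor A b₀}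
  have hV : V.Finite := (finite_projVertex hfin).subset fun A hA => hA.1
  have hscale : ∀ v, IsProjVertex (S \ {b₀}) v → 0 < lor v b₀ →
      ∃ d : ℝ, 0 < d ∧ d • v ∈ V := by
    intro v hv hvb
    obtain ⟨d, hd, hdv⟩ := exists_smul_mem_coneSlice hfin hspan hv.2.1 hv.1
    exact ⟨d, hd, ⟨hv.smul hd, hdv⟩, by rw [lor_smul_left]; positivity⟩
  have hratio : ∀ (v : Vec n) {d : ℝ}, 0 < d →
      lor x (d • v) / lor (d • v) b₀ = lor x v / lor v b₀ := fun v d hd => by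
    rw [lor_smul_left, lor_smul_right, mul_div_mul_left _ _ hd.ne']
  obtain ⟨d₁, hd₁, hd₁V⟩ := hscale A₁ hA₁ hA₁b
  -- `x - c • b₀` satisfies the condition of a visible facet `v` exactly when `c` is at least this
  -- ratio; the facet with the largest ratio is the last one crossed.
  obtain ⟨A, hAV, hmax⟩ := exists_max_image V (fun v => lor x v / lor v b₀) hV ⟨_, hd₁V⟩
  obtain ⟨⟨hA, -⟩, hAb⟩ := hAV
  refine ⟨A, hA, hAb, ?_⟩
  set c := lor x A / lor A b₀ with hc
  have hcpos : 0 < c := by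
    refine lt_of_lt_of_le ?_ (hmax _ hd₁V)
    rw [hratio _ hd₁]
    positivity
  have hcA : c * lor A b₀ = lor x A := div_mul_cancel₀ _ hAb.ne'
  have hy : x - c • b₀ ∈ dualCone (S \ {b₀}) := by
    refine mem_dualCone_of_vertices hfin hspan fun v hv => ?_
    rw [lor_sub_left, lor_smul_left, lor_comm b₀]
    rcases lt_or_ge 0 (lor v b₀) with hvb | hvb
    · obtain ⟨d, hd, hdV⟩ := hscale v hv hvb
      have := hmax _ hdV
      rw [hratio _ hd, div_le_iff₀ hvb] at this
      linarith
    -- For an invisible facet `v`, combine `v` with `A` so that the product with `b₀` vanishes; the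
    -- result is a valid inequality for the cone of `S`.
    · have hw : lor A b₀ • v + (-lor v b₀) • A ∈ halfspaceCone S := by
        refine mem_halfspaceCone_of_diff (b₀ := b₀) (add_mem_halfspaceCone
          (smul_mem_halfspaceCone hv.2.1 hAb.le)
          (smul_mem_halfspaceCone hA.2.1 (by linarith))) (le_of_eq ?_)
        rw [lor_add_left, lor_smul_left, lor_smul_left]
        ring
      have := hx _ hw
      rw [lor_add_right, lor_smul_right, lor_smul_right, ← hcA] at this
      have h2 : lor A b₀ * (lor x v - c * lor v b₀) ≤ 0 := by linarith
      exact nonpos_of_mul_nonpos_right h2 hAb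
  intro w hw
  -- Adding a multiple of `A` is harmless, since `x - c • b₀` is orthogonal to `A`.
  obtain ⟨M, -, hM⟩ := exists_smul_add_mem hfin hA.2.1
    fun b hb => hw b (mem_insert_of_mem _ hb)
  have h1 := hy _ hM
  have h2 := hw b₀ (mem_insert _ _)
  rw [lor_add_right, lor_smul_right, lor_sub_left x (c • b₀) A, lor_smul_left, lor_comm b₀ A, hcA,
    sub_self, mul_zero, add_zero, lor_sub_left, lor_smul_left, lor_comm b₀ w] at h1
  nlinarith

lemma span_insert_tight (hS : S.Finite) (hA : IsProjVertex S A) (h : lor A b₀ ≠ 0) :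
    Submodule.span ℝ (insert b₀ (tight S A)) = ⊤ := by
  refine span_eq_top_of_orthogonal fun v hv => ?_
  obtain ⟨c, rfl⟩ := hA.exists_eq_smul hS fun b hb => hv b (mem_insert_of_mem _ hb)
  have := hv b₀ (mem_insert _ _)
  rw [lor_smul_left] at this
  rw [(mul_eq_zero.1 this).resolve_right h, zero_smul]

lemma neg_mem_halfspaceCone_insert_tight (h : 0 ≤ lor A b₀) :
    -A ∈ halfspaceCone (insert b₀ (tight S A)) := by
  rintro b (rfl | hb)
  · rw [lor_neg_left]
    linarith
  · rw [lor_neg_left, hb.2, neg_zero]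

/-- The normalized difference of two facet normals lies in the cone of the second facet. -/
lemma sub_mem_halfspaceCone (hA : A ∈ halfspaceCone S) (hA0 : 0 < lor A b₀)
    (hB0 : 0 < lor B b₀) :
    (lor A b₀)⁻¹ • A - (lor B b₀)⁻¹ • B ∈ halfspaceCone (insert b₀ (tight S B)) := by
  rintro b (rfl | hb)
  · rw [lor_sub_left, lor_smul_left, lor_smul_left, inv_mul_cancel₀ hA0.ne',
      inv_mul_cancel₀ hB0.ne', sub_self]
  · rw [lor_sub_left, lor_smul_left, lor_smul_left, hb.2, mul_zero, sub_zero]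
    exact mul_nonpos_of_nonneg_of_nonpos (inv_nonneg.2 hA0.le) (hA b hb.1)

/-- The parts are `S \ {b₀}` and the joins `F A` of `b₀` with the visible facets `A`. The vector `A`
separates `F A` from `S \ {b₀}`, and two joins are separated by the difference of their normals,
scaled to agree on `b₀`. -/
lemma PoleConfig.exists_isCut (hn : 1 < n) (hS : PoleConfig P S) (hb₀ : b₀ ∈ S)
    (hspan : Submodule.span ℝ (S \ {b₀}) = ⊤) : ∃ 𝒞, IsCut S 𝒞 := by
  set S' := S \ {b₀} with hS'
  have hfin : S'.Finite := hS.finite.subset sdiff_subset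
  let F : Vec n → Set (Vec n) := fun A => insert b₀ (tight S' A)
  have hFS : ∀ A, F A ⊆ S := fun A => insert_subset hb₀ (tight_subset.trans sdiff_subset)
  have hFspan : ∀ A, IsProjVertex S' A → 0 < lor A b₀ → Submodule.span ℝ (F A) = ⊤ :=
    fun A hA h => span_insert_tight hfin hA h.ne'
  have hdual : ∀ T ⊆ S, Submodule.span ℝ T = ⊤ → ∀ x ∈ cutPolytope T, x.1 ∈ dualCone T :=
    fun T hT hTs x hx => ((hS.cutPolytope_subset hn hT hTs).subset hx).2
  let 𝒞 : Set (Set (Vec n)) := insert S' {T | ∃ A, IsProjVertex S' A ∧ 0 < lor A b₀ ∧ T = F A}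
  have hspans : ∀ T ∈ 𝒞, Submodule.span ℝ T = ⊤ := by
    rintro T (rfl | ⟨A, hA, h, rfl⟩)
    · exact hspan
    · exact hFspan A hA h
  have hsub : ∀ T ∈ 𝒞, T ⊂ S := by
    rintro T (rfl | ⟨A, hA, h, rfl⟩)
    · exact ⟨sdiff_subset, fun h => (h hb₀).2 rfl⟩
    · refine ⟨hFS A, fun hcon => hA.1 (eq_zero_of_span hspan fun b hb => ?_)⟩
      rcases hcon hb.1 with h1 | h1
      · exact (hb.2 h1).elim
      · exact h1.2
  have hdisj : ∀ A, IsProjVertex S' A → 0 < lor A b₀ →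
      Disjoint (interior (cutPolytope S')) (interior (cutPolytope (F A))) := by
    intro A hA h
    refine disjoint_interior_of_orthogonal hA.1 fun x hx hx' => ?_
    have h1 := hdual _ sdiff_subset hspan x hx A hA.2.1
    have h2 := hdual _ (hFS A) (hFspan A hA h) x hx' _ (neg_mem_halfspaceCone_insert_tight h.le)
    rw [lor_neg_right] at h2
    linarith
  refine ⟨𝒞, hsub, hspans, fun T hT => hS.walls hn (hsub T hT).1 (hspans T hT), ?_, ?_⟩
  · apply Subset.antisymm
    · intro x hx
      have hx' := hx
      rw [hS.cutPolytope_eq hn] at hx'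
      simp only [mem_iUnion]
      rcases hS.mem_dualCone_diff_or hspan hx'.2 with h | ⟨A, hA, hAb, h⟩
      · exact ⟨S', mem_insert _ _,
          (hS.cutPolytope_subset hn sdiff_subset hspan).symm.subset ⟨hx, h⟩⟩
      · exact ⟨F A, mem_insert_of_mem _ ⟨A, hA, hAb, rfl⟩,
          (hS.cutPolytope_subset hn (hFS A) (hFspan A hA hAb)).symm.subset ⟨hx, h⟩⟩
    · refine iUnion₂_subset fun T hT => ?_
      rw [hS.cutPolytope_subset hn (hsub T hT).1 (hspans T hT)]
      exact inter_subset_left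
  · rintro T (rfl | ⟨A, hA, hAb, rfl⟩) T' (rfl | ⟨B, hB, hBb, rfl⟩) hne
    · exact (hne rfl).elim
    · exact hdisj B hB hBb
    · exact (hdisj A hA hAb).symm
    -- Proportional normals have the same tight poles and would give the same part.
    · have hv : (lor A b₀)⁻¹ • A - (lor B b₀)⁻¹ • B ≠ 0 := by
        intro h0
        have hAB : A = (lor A b₀ * (lor B b₀)⁻¹) • B := by
          rw [mul_smul, ← sub_eq_zero.1 h0, smul_inv_smul₀ hAb.ne']
        apply hne
        have hpos : lor A b₀ * (lor B b₀)⁻¹ ≠ 0 := (mul_pos hAb (inv_pos.2 hBb)).ne'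
        have : tight S' A = tight S' B := by
          ext b
          refine and_congr_right fun _ => ?_
          conv_lhs => rw [hAB, lor_smul_left]
          exact mul_eq_zero_iff_left hpos
        simp only [F, this]
      refine disjoint_interior_of_orthogonal hv fun x hx hx' => ?_
      have h1 := hdual _ (hFS B) (hFspan B hB hBb) x hx' _
        (sub_mem_halfspaceCone hA.2.1 hAb hBb)
      have h2 := hdual _ (hFS A) (hFspan A hA hAb) x hx _
        (sub_mem_halfspaceCone hB.2.1 hBb hAb)
      rw [lor_sub_right] at h1 h2 ⊢
      linarith

/-- Any `b₀` not orthogonal to `A` works. Otherwise some vector is orthogonal to all of `S` except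
`b₀`; suitably scaled it is a vertex of `D'(S)` on all base planes through `A`, which non-adjacency
excludes. -/
lemma IsCuttingPoint.exists_span (hS : Submodule.span ℝ S = ⊤) (hA : IsCuttingPoint S A) :
    ∃ b₀ ∈ S, Submodule.span ℝ (S \ {b₀}) = ⊤ := by
  have hA0 : A ≠ 0 := by
    rintro rfl
    have := hA.1
    simp [lor_zero_left] at this
  obtain ⟨b₀, hb₀, hAb⟩ : ∃ b ∈ S, lor A b ≠ 0 := by
    by_contra! h
    exact hA0 (eq_zero_of_span hS h)
  refine ⟨b₀, hb₀, ?_⟩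
  by_contra hspan
  obtain ⟨e, he, he0⟩ : ∃ e : Vec n, (∀ b ∈ S \ {b₀}, lor e b = 0) ∧ e ≠ 0 := by
    by_contra! h
    exact hspan (span_eq_top_of_orthogonal h)
  have heb : lor e b₀ ≠ 0 := fun h => he0 (eq_zero_of_span hS fun b hb => by
    by_cases hbb : b = b₀
    · rwa [hbb]
    · exact he b ⟨hb, hbb⟩)
  set f := (-(lor e b₀)⁻¹) • e with hf
  have hfb : lor f b₀ = -1 := by
    rw [hf, lor_smul_left, neg_mul, inv_mul_cancel₀ heb]
  have hfS : ∀ b ∈ S \ {b₀}, lor f b = 0 := fun b hb => by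
    rw [hf, lor_smul_left, he b hb, mul_zero]
  refine hA.2.2 ⟨f, ⟨?_, ?_, fun x hx y hy hxy => ⟨-lor x b₀, ?_⟩⟩, fun b hb hAb' => hfS b
    ⟨hb, fun h => hAb (h ▸ hAb')⟩⟩
  · intro h0
    rw [h0, lor_zero_left] at hfb
    norm_num at hfb
  · exact mem_halfspaceCone_of_diff (fun b hb => (hfS b hb).le) (by rw [hfb]; norm_num)
  · rw [← sub_eq_zero]
    refine eq_zero_of_span hS fun b hb => ?_
    rw [lor_sub_left, lor_smul_left]
    by_cases hbb : b = b₀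
    · rw [hbb, hfb]; ring
    · have h1 := hfS b ⟨hb, hbb⟩
      have h2 := hx b hb
      have h3 := hy b hb
      rw [h1]
      rw [← hxy, lor_add_left] at h1
      linarith

/-! ### Polytopes without cutting points are truncated simplices -/

/-- If `b₀` depends on the other poles, these still span, and any facet of their cone visible from
`b₀` is a cutting point. Without one, `b₀` is in their cone; but it is also in `halfspaceCone (S \
{b₀})`, contradicting `⟨b₀, b₀⟩ = 1`. -/
lemma PoleConfig.linearIndependent (hn : 1 < n) (hS : PoleConfig P S)
    (hcut : ∀ A, ¬ IsCuttingPoint S A) : LinearIndependent ℝ ((↑) : S → Vec n) := by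
  rw [linearIndependent_iff_notMem_span]
  rintro ⟨b₀, hb₀⟩ hmem
  have himg : ((↑) : S → Vec n) '' (univ \ {⟨b₀, hb₀⟩}) = S \ {b₀} := by
    ext b
    constructor
    · rintro ⟨⟨b, hb⟩, h, rfl⟩
      exact ⟨hb, fun h' => h.2 (Subtype.ext h')⟩
    · rintro ⟨hb, h⟩
      exact ⟨⟨b, hb⟩, ⟨mem_univ _, fun h' => h (congrArg Subtype.val h')⟩, rfl⟩
  rw [himg] at hmem
  have hspan : Submodule.span ℝ (S \ {b₀}) = ⊤ := by
    rw [eq_top_iff, ← hS.span, Submodule.span_le]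
    intro b hb
    by_cases hbb : b = b₀
    · rw [hbb]; exact hmem
    · exact Submodule.subset_span ⟨hb, hbb⟩
  have hfin : (S \ {b₀}).Finite := hS.finite.subset sdiff_subset
  have hdual : b₀ ∈ dualCone (S \ {b₀}) := by
    refine mem_dualCone_of_vertices hfin hspan fun A hA => ?_
    rw [lor_comm]
    by_contra! hpos
    obtain ⟨b, hb, hbA⟩ := exists_lor_neg hspan hA.2.1 hA.1
    exact hcut A (hS.isCuttingPoint hn sdiff_subset hA.1 (fun x => hA.exists_eq_smul hfin)
      ⟨b₀, hb₀, hpos⟩ ⟨b, hb.1, hbA⟩)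
  have := hdual b₀ (hS.mem_halfspaceCone sdiff_subset hb₀ fun h => h.2 rfl)
  rw [hS.unit b₀ hb₀] at this
  linarith

lemma PoleConfig.isTruncatedSimplex (hn : 1 < n) (hS : PoleConfig P S)
    (hli : LinearIndependent ℝ ((↑) : S → Vec n)) :
    ∃ B : Fin (n + 1) → Vec n, Set.range B = S ∧ IsTruncatedSimplex B (cutPolytope S) := by
  have := hS.finite.fintype
  let 𝔅 := Module.Basis.mk hli (by rw [Subtype.range_coe, hS.span])
  have hcard : Fintype.card S = Fintype.card (Fin (n + 1)) := by
    rw [← Module.finrank_eq_card_basis 𝔅, Module.finrank_fin_fun, Fintype.card_fin]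
  let e : Fin (n + 1) ≃ S := (Fintype.equivOfCardEq hcard).symm
  let 𝔅' := 𝔅.reindex e.symm
  have h𝔅' : ∀ i, 𝔅' i = (e i).1 := fun i => by
    simp [𝔅', 𝔅]
  have hrange : Set.range (fun i => (e i).1) = S := by
    have : (fun i => (e i).1) = Subtype.val ∘ e := rfl
    rw [this, range_comp, e.surjective.range_eq, image_univ, Subtype.range_coe]
  refine ⟨fun i => (e i).1, hrange, hli.comp _ e.injective, fun i => hS.unit _ (e i).2,
    fun i j hij => hS.lt _ (e i).2 _ (e j).2 fun h => hij (e.injective (Subtype.ext h)), ?_⟩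
  rw [hS.cutPolytope_eq hn]
  ext x
  have hall : (∀ i, lor x.1 (e i).1 ≤ 0) ↔ x.1 ∈ halfspaceCone S := by
    constructor
    · intro h b hb
      simpa using h (e.symm ⟨b, hb⟩)
    · exact fun h i => h _ (e i).2
  change _ ∧ _ ↔ _ ∧ _
  rw [hall, and_comm]
  refine and_congr_left fun _ => ⟨fun h => ⟨fun i => 𝔅'.repr x.1 i, fun i => ?_, ?_⟩, ?_⟩
  -- The negative dual basis vectors lie in `halfspaceCone S`, so testing against them shows that
  -- the coordinates are nonnegative.
  · obtain ⟨v, hv⟩ := exists_lor_eq (-𝔅'.coord i)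
    have hvS : v ∈ halfspaceCone S := by
      rw [← hrange]
      rintro _ ⟨j, rfl⟩
      change lor v (e j).1 ≤ 0
      rw [hv, ← h𝔅']
      by_cases hij : j = i <;> simp [hij]
    have := h v hvS
    rw [lor_comm, hv] at this
    simpa using this
  · simp only [← h𝔅']
    exact (𝔅'.sum_repr x.1).symm
  · rintro ⟨c, hc, hx⟩ A hA
    rw [hx, lor_sum_left]
    refine Finset.sum_nonpos fun i _ => ?_
    rw [lor_smul_left, lor_comm]
    exact mul_nonpos_of_nonneg_of_nonpos (hc i) (hA _ (e i).2)

/-! ### Running the algorithm -/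

lemma PoleConfig.exists_isCut_of_isCuttingPoint (hn : 1 < n) (hS : PoleConfig P S)
    (hA : IsCuttingPoint S A) : ∃ 𝒞, IsCut S 𝒞 := by
  obtain ⟨b₀, hb₀, hspan⟩ := hA.exists_span hS.span
  exact hS.exists_isCut hn hb₀ hspan

lemma PoleConfig.exists_cutResult (hn : 1 < n) (hS : PoleConfig P S) : ∃ 𝒯, CutResult S 𝒯 := by
  induction hk : S.ncard using Nat.strong_induction_on generalizing S with
  | _ k ih =>
    by_cases hA : ∃ A, IsCuttingPoint S A
    · have ⟨A, hA'⟩ := hA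
      obtain ⟨𝒞, h𝒞⟩ := hS.exists_isCut_of_isCuttingPoint hn hA'
      have : ∀ T, ∃ r, T ∈ 𝒞 → CutResult T r := by
        intro T
        by_cases hT : T ∈ 𝒞
        · have hlt := ncard_lt_ncard (h𝒞.ssubset T hT) hS.finite
          obtain ⟨r, hr⟩ := ih _ (hk ▸ hlt) (hS.subset (h𝒞.ssubset T hT).1 (h𝒞.span T hT)) rfl
          exact ⟨r, fun _ => hr⟩
        · exact ⟨∅, fun h => (hT h).elim⟩
      choose r hr using this
      exact ⟨_, CutResult.cut S 𝒞 hA h𝒞 r hr⟩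
    · push Not at hA
      exact ⟨_, CutResult.keep S hA⟩

lemma CutResult.spec {𝒯 : Set (Set (Vec n))} (h : CutResult S 𝒯) (hS : PoleConfig P S) :
    (∀ T ∈ 𝒯, T ⊆ S ∧ Submodule.span ℝ T = ⊤ ∧ ∀ A, ¬ IsCuttingPoint T A) ∧
    cutPolytope S = ⋃ T ∈ 𝒯, cutPolytope T ∧
    ∀ T ∈ 𝒯, ∀ T' ∈ 𝒯, T ≠ T' → Disjoint (interior (cutPolytope T)) (interior (cutPolytope T')) := by
  induction h with
  | keep S h =>
    refine ⟨?_, by simp, ?_⟩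
    · rintro T rfl
      exact ⟨Subset.rfl, hS.span, h⟩
    · rintro T rfl T' rfl hne
      exact (hne rfl).elim
  | cut S 𝒞 hA hcut r hr ih =>
    have ih' := fun T hT => ih T hT (hS.subset (hcut.ssubset T hT).1 (hcut.span T hT))
    have hsub : ∀ C ∈ 𝒞, ∀ T ∈ r C, cutPolytope T ⊆ cutPolytope C := fun C hC T hT => by
      rw [(ih' C hC).2.1]
      exact subset_biUnion_of_mem hT
    refine ⟨?_, ?_, ?_⟩
    · intro T hT
      obtain ⟨C, hC, hTC⟩ := mem_iUnion₂.1 hT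
      obtain ⟨h1, h2, h3⟩ := (ih' C hC).1 T hTC
      exact ⟨h1.trans (hcut.ssubset C hC).1, h2, h3⟩
    · rw [hcut.covers]
      ext x
      simp only [mem_iUnion, exists_prop]
      constructor
      · rintro ⟨C, hC, hx⟩
        rw [(ih' C hC).2.1] at hx
        obtain ⟨T, hT, hxT⟩ := mem_iUnion₂.1 hx
        exact ⟨T, ⟨C, hC, hT⟩, hxT⟩
      · rintro ⟨T, ⟨C, hC, hT⟩, hx⟩
        exact ⟨C, hC, hsub C hC T hT hx⟩
    · intro T hT T' hT' hne
      obtain ⟨C, hC, hTC⟩ := mem_iUnion₂.1 hT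
      obtain ⟨C', hC', hTC'⟩ := mem_iUnion₂.1 hT'
      by_cases hCC : C = C'
      · subst hCC
        exact (ih' C hC).2.2 T hTC T' hTC' hne
      · exact (hcut.disjoint C hC C' hC' hCC).mono (interior_mono (hsub C hC T hTC))
          (interior_mono (hsub C' hC' T' hTC'))

end Cutting

/-! ### Distances from hyperplanes -/

section Distance

variable {n : ℕ} {h : ℝ} {𝓑 : Set (Set (Hyp n))} {b g : Vec n}

lemma lor_neg_hyp (x y : Hyp n) : lor x.1 y.1 < 0 :=
  lor_neg_of_future x.2.1 x.2.2 (by rw [y.2.1]; norm_num) y.2.2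

lemma lor_le_neg_one (x y : Hyp n) : lor x.1 y.1 ≤ -1 := by
  have h1 := reverse_cauchy_schwarz x.2.1 y.1
  rw [y.2.1] at h1
  nlinarith [lor_neg_hyp x y]

/-- The foot of the perpendicular from a point to a hyperplane. -/
lemma exists_foot (hb : lor b b = 1) (x : Hyp n) :
    ∃ y : Hyp n, lor y.1 b = 0 ∧ x.1 = √(1 + lor x.1 b ^ 2) • y.1 + lor x.1 b • b := by
  set t := lor x.1 b with ht
  have h1 : lor (x.1 - t • b) (x.1 - t • b) = -(1 + t ^ 2) := by
    simp only [lor_sub_left, lor_sub_right, lor_smul_left, lor_smul_right, x.2.1, hb,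
      lor_comm b x.1, ← ht]
    ring
  have h2 : lor x.1 (x.1 - t • b) = -(1 + t ^ 2) := by
    simp only [lor_sub_right, lor_smul_right, x.2.1, ← ht]
    ring
  have hpos : 0 < 1 + t ^ 2 := by positivity
  have htl : lor (x.1 - t • b) (x.1 - t • b) < 0 := by rw [h1]; linarith
  have hfut := zeroth_pos x.2.1 x.2.2 htl (by rw [h2]; linarith)
  refine ⟨toHyp _ htl hfut, ?_, ?_⟩
  · obtain ⟨c, -, hc⟩ := exists_smul_toHyp htl hfut
    rw [hc, lor_smul_left, lor_sub_left, lor_smul_left, hb, ← ht]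
    ring
  · change x.1 = √(1 + t ^ 2) • (√(-lor (x.1 - t • b) (x.1 - t • b)))⁻¹ • (x.1 - t • b) + t • b
    rw [h1, neg_neg, smul_inv_smul₀ (Real.sqrt_pos.2 hpos).ne', sub_add_cancel]

/-- With `y` the foot of the perpendicular, `⟨x, z⟩` is `√(1 + ⟨x, b⟩²) * ⟨y, z⟩` for `z` in the
hyperplane, and `⟨y, z⟩ ≤ -1` with equality at `z = y`. -/
lemma distTo_polarPlane (hb : lor b b = 1) (x : Hyp n) :
    distTo x (polarPlane b) = Real.arcosh √(1 + lor x.1 b ^ 2) := by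
  obtain ⟨y, hy, hx⟩ := exists_foot hb x
  have hs : 0 < √(1 + lor x.1 b ^ 2) := Real.sqrt_pos.2 (by positivity)
  have hz : ∀ z ∈ polarPlane b, lor x.1 z.1 = √(1 + lor x.1 b ^ 2) * lor y.1 z.1 := by
    intro z hz
    have hz' : lor b z.1 = 0 := by rw [lor_comm]; exact hz
    conv_lhs => rw [hx, lor_add_left, lor_smul_left, lor_smul_left, hz', mul_zero, add_zero]
  have hle : ∀ z : polarPlane b, Real.arcosh √(1 + lor x.1 b ^ 2) ≤ hdist x z.1 := by
    intro z
    have h1 := lor_le_neg_one y z.1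
    have h2 : √(1 + lor x.1 b ^ 2) ≤ -lor x.1 z.1.1 := by
      rw [hz z.1 z.2]
      nlinarith
    exact (Real.arcosh_le_arcosh hs (hs.trans_le h2)).2 h2
  have : Nonempty (polarPlane b) := ⟨⟨y, hy⟩⟩
  refine le_antisymm ((ciInf_le ⟨Real.arcosh √(1 + lor x.1 b ^ 2), ?_⟩ ⟨y, hy⟩).trans (le_of_eq ?_)) (le_ciInf hle)
  · rintro _ ⟨z, rfl⟩
    exact hle z
  · rw [hdist, hz y hy, y.2.1, mul_neg_one, neg_neg]

lemma distTo_le_distTo (hb : lor b b = 1) (hg : lor g g = 1) (x y : Hyp n) :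
    distTo x (polarPlane b) ≤ distTo y (polarPlane g) ↔ |lor x.1 b| ≤ |lor y.1 g| := by
  rw [distTo_polarPlane hb, distTo_polarPlane hg,
    Real.arcosh_le_arcosh (Real.sqrt_pos.2 (by positivity)) (Real.sqrt_pos.2 (by positivity)),
    Real.sqrt_le_sqrt_iff (by positivity), add_le_add_iff_left, sq_le_sq]

lemma hyperball_polarPlane (hh : 0 < h) (hb : lor b b = 1) :
    hyperball h (polarPlane b) = {x | |lor x.1 b| ≤ Real.sinh h} := by
  ext x
  change distTo x (polarPlane b) ≤ h ↔ |lor x.1 b| ≤ Real.sinh h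
  conv_lhs => rw [distTo_polarPlane hb, ← Real.arcosh_cosh hh.le]
  rw [Real.arcosh_le_arcosh (Real.sqrt_pos.2 (by positivity)) (Real.cosh_pos h),
    Real.sqrt_le_left (Real.cosh_pos h).le, Real.cosh_sq']
  rw [add_le_add_iff_left, sq_le_sq, abs_of_pos (Real.sinh_pos_iff.2 hh)]

lemma mem_interior_hyperball (hh : 0 < h) (hb : lor b b = 1) {x : Hyp n}
    (hx : |lor x.1 b| < Real.sinh h) : x ∈ interior (hyperball h (polarPlane b)) := by
  rw [hyperball_polarPlane hh hb]
  refine interior_maximal (t := {x : Hyp n | |lor x.1 b| < Real.sinh h})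
    (fun y (hy : |lor y.1 b| < Real.sinh h) => hy.le) ?_ hx
  exact isOpen_lt (by fun_prop) continuous_const

lemma polarPlane_smul {c : ℝ} (hc : c ≠ 0) : polarPlane (c • b) = polarPlane b := by
  ext x
  change lor x.1 (c • b) = 0 ↔ lor x.1 b = 0
  rw [lor_smul_right, mul_eq_zero_iff_left hc]

lemma polarPlane_neg : polarPlane (-b) = polarPlane b := by
  rw [← neg_one_smul ℝ, polarPlane_smul (by norm_num)]

lemma IsHyperplane.exists_pole {β : Set (Hyp n)} (hβ : IsHyperplane β) :
    ∃ b : Vec n, lor b b = 1 ∧ polarPlane b = β := by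
  obtain ⟨b, hb, rfl⟩ := hβ
  have hs := Real.sqrt_pos.2 hb
  refine ⟨(√(lor b b))⁻¹ • b, ?_, polarPlane_smul (inv_pos.2 hs).ne'⟩
  rw [lor_smul_left, lor_smul_right, ← mul_assoc, ← mul_inv, Real.mul_self_sqrt hb.le,
    inv_mul_cancel₀ hb.ne']

/-- The base point `(1, 0, …, 0)`. -/
def origin : Hyp n := ⟨Pi.single 0 1, by simp [lor], by simp⟩

lemma exists_mem_polarPlane (hb : lor b b = 1) : ∃ y : Hyp n, lor y.1 b = 0 :=
  let ⟨y, hy, _⟩ := exists_foot hb origin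
  ⟨y, hy⟩

lemma eq_or_eq_neg_of_polarPlane_eq (hb : lor b b = 1) (hg : lor g g = 1)
    (heq : polarPlane b = polarPlane g) : g = b ∨ g = -b := by
  obtain ⟨x, hx⟩ := exists_mem_polarPlane hb
  have hxg : lor x.1 g = 0 := heq.subset hx
  set c := lor b g with hc
  set w := g - c • b with hw
  have hxw : lor x.1 w = 0 := by rw [hw, lor_sub_right, lor_smul_right, hx, hxg]; ring
  have hwb : lor w b = 0 := by rw [hw, lor_sub_left, lor_smul_left, hb, lor_comm g, ← hc]; ring
  have hwg : lor w g = lor w w := by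
    conv_rhs => rw [hw, lor_sub_right, ← hw, lor_smul_right, hwb, mul_zero, sub_zero]
  have hww : lor w w = 1 - c ^ 2 := by
    rw [← hwg, hw, lor_sub_left, lor_smul_left, hg, ← hc]; ring
  have hw0 : w = 0 := by
    by_contra hne
    have hpos := lor_self_pos_of_orthogonal (by rw [x.2.1]; norm_num) hxw hne
    have ht : Tendsto (fun t : ℝ => x.1 + t • w) (𝓝[≠] 0) (𝓝 x.1) := by
      have : Continuous fun t : ℝ => x.1 + t • w := by fun_prop
      simpa using (this.tendsto 0).mono_left nhdsWithin_le_nhds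
    obtain ⟨t, ⟨y, -, d, hd, hyd⟩, ht0⟩ :=
      ((ht.eventually (eventually_ray_mem univ_mem)).and self_mem_nhdsWithin).exists
    have h1 : y ∈ polarPlane b := by
      change lor y.1 b = 0
      rw [hyd, lor_smul_left, lor_add_left, lor_smul_left, hx, hwb]; ring
    have h2 : lor y.1 g = 0 := heq.subset h1
    rw [hyd, lor_smul_left, lor_add_left, lor_smul_left, hxg, hwg, zero_add] at h2
    exact (mul_ne_zero hd.ne' (mul_ne_zero ht0 hpos.ne')) h2
  have hgc : g = c • b := sub_eq_zero.1 hw0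
  rw [hw0, lor_zero_left] at hww
  have : c = 1 ∨ c = -1 := sq_eq_one_iff.1 (by linarith)
  rcases this with h1 | h1
  · left; rw [hgc, h1, one_smul]
  · right; rw [hgc, h1, neg_one_smul]

/-- Two hyperplanes that are not ultraparallel have points arbitrarily close to both. -/
lemma exists_near_both (hb : lor b b = 1) (hg : lor g g = 1) (hc : |lor b g| ≤ 1)
    (h1 : g ≠ b) (h2 : g ≠ -b) {σ : ℝ} (hσ : 0 < σ) :
    ∃ x : Hyp n, lor x.1 b = 0 ∧ |lor x.1 g| < σ := by
  obtain ⟨x, hx⟩ := exists_mem_polarPlane hb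
  set c := lor b g with hcdef
  set w := g - c • b with hw
  set a := lor x.1 w with ha
  have hwb : lor w b = 0 := by rw [hw, lor_sub_left, lor_smul_left, hb, lor_comm g, ← hcdef]; ring
  have hgw : g = w + c • b := by rw [hw, sub_add_cancel]
  have hww : lor w w = 1 - c ^ 2 := by
    conv_lhs => rw [hw]
    simp only [lor_sub_right, lor_sub_left, lor_smul_right, lor_smul_left, hg, hb, lor_comm g b,
      ← hcdef]
    ring
  have hc2 : c ^ 2 ≤ 1 := by rw [← sq_abs]; nlinarith [abs_nonneg c]
  have hw0 : w ≠ 0 := by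
    intro h0
    rw [h0, lor_zero_left] at hww
    have : (c - 1) * (c + 1) = 0 := by linarith
    rw [h0, zero_add] at hgw
    rcases mul_eq_zero.1 this with h3 | h3
    · exact h1 (by rw [hgw, show c = 1 by linarith, one_smul])
    · exact h2 (by rw [hgw, show c = -1 by linarith, neg_one_smul])
  have hgen : ∀ s : ℝ, lor (x.1 - s • w) (x.1 - s • w) = -1 - 2 * s * a + s ^ 2 * (1 - c ^ 2) := by
    intro s
    simp only [lor_sub_right, lor_sub_left, lor_smul_right, lor_smul_left, x.2.1, hww,
      lor_comm w x.1, ← ha]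
    ring
  have hmk : ∀ s : ℝ, 0 ≤ s * a → lor (x.1 - s • w) (x.1 - s • w) < 0 →
      ∃ y : Hyp n, lor y.1 b = 0 ∧ ∃ d : ℝ, 0 < d ∧ y.1 = d • (x.1 - s • w) ∧
        lor y.1 g = d * (a - s * (1 - c ^ 2)) := by
    intro s hs htl
    have hfut := zeroth_pos x.2.1 x.2.2 htl (by
      rw [lor_sub_right, lor_smul_right, x.2.1, ← ha]; linarith)
    obtain ⟨d, hd, hy⟩ := exists_smul_toHyp htl hfut
    have hyb : lor (toHyp _ htl hfut).1 b = 0 := by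
      rw [hy, lor_smul_left, lor_sub_left, lor_smul_left, hx, hwb]; ring
    refine ⟨toHyp _ htl hfut, hyb, d, hd, hy, ?_⟩
    rw [hgw, lor_add_right, lor_smul_right, hyb, hy, lor_smul_left, lor_sub_left, lor_smul_left,
      hww, ← ha]
    ring
  rcases hc2.lt_or_eq with hlt | heq
  -- Intersecting hyperplanes: this multiple of `w` moves `x` along the first hyperplane to a point
  -- of the second.
  · have hpos : 0 < 1 - c ^ 2 := by linarith
    obtain ⟨y, hyb, d, -, -, hyg⟩ := hmk (a / (1 - c ^ 2))
      (by rw [div_mul_eq_mul_div]; exact div_nonneg (mul_self_nonneg a) hpos.le)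
      (by
        rw [hgen]
        have : a / (1 - c ^ 2) * (1 - c ^ 2) = a := div_mul_cancel₀ _ hpos.ne'
        have h3 : 0 ≤ a / (1 - c ^ 2) * a := by
          rw [div_mul_eq_mul_div]; exact div_nonneg (mul_self_nonneg a) hpos.le
        have h4 : (a / (1 - c ^ 2)) ^ 2 * (1 - c ^ 2) = a / (1 - c ^ 2) * a := by
          rw [sq (a / _), mul_assoc, this]
        rw [h4]
        linarith)
    refine ⟨y, hyb, ?_⟩
    rw [hyg, div_mul_cancel₀ _ hpos.ne', sub_self, mul_zero, abs_zero]
    exact hσ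
  -- Parallel hyperplanes: `w` is null and represents their common ideal point. Moving `x` far
  -- enough towards it, by a multiple of order `1/σ²`, brings it within `σ` of the second
  -- hyperplane.
  · have ha0 : a ≠ 0 := by
      intro h0
      have := lor_self_pos_of_orthogonal (by rw [x.2.1]; norm_num) h0 hw0
      linarith
    have hs : 0 < (σ ^ 2)⁻¹ := by positivity
    have hq : -1 - 2 * ((σ ^ 2)⁻¹ * a) * a + ((σ ^ 2)⁻¹ * a) ^ 2 * (1 - c ^ 2) =
        -(1 + 2 * (σ ^ 2)⁻¹ * a ^ 2) := by rw [heq]; ring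
    have hq0 : 0 < 1 + 2 * (σ ^ 2)⁻¹ * a ^ 2 := by positivity
    obtain ⟨y, hyb, d, hd, hy, hyg⟩ := hmk ((σ ^ 2)⁻¹ * a) (by nlinarith [mul_self_nonneg a])
      (by rw [hgen, hq]; linarith)
    refine ⟨y, hyb, ?_⟩
    have hyy := y.2.1
    rw [hy, lor_smul_left, lor_smul_right, hgen, hq] at hyy
    rw [hyg, heq, sub_self, mul_zero, sub_zero]
    refine abs_lt_of_sq_lt_sq ?_ hσ.le
    have e1 : d ^ 2 * (1 + 2 * (σ ^ 2)⁻¹ * a ^ 2) = 1 := by linarith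
    have e2 : σ ^ 2 * (1 + 2 * (σ ^ 2)⁻¹ * a ^ 2) = σ ^ 2 + 2 * a ^ 2 := by
      field_simp
    have e3 : a ^ 2 < σ ^ 2 * (1 + 2 * (σ ^ 2)⁻¹ * a ^ 2) := by rw [e2]; nlinarith [sq_nonneg a, pow_pos hσ 2]
    calc (d * a) ^ 2 = d ^ 2 * a ^ 2 := by ring
      _ < d ^ 2 * (σ ^ 2 * (1 + 2 * (σ ^ 2)⁻¹ * a ^ 2)) := by
        exact mul_lt_mul_of_pos_left e3 (by positivity)
      _ = σ ^ 2 * (d ^ 2 * (1 + 2 * (σ ^ 2)⁻¹ * a ^ 2)) := by ring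
      _ = σ ^ 2 := by rw [e1, mul_one]

end Distance

/-! ### Poles of a saturated packing -/

/-- `g` is a normalized pole of a hyperplane of the packing. -/
def IsPole {n : ℕ} (𝓑 : Set (Set (Hyp n))) (g : Vec n) : Prop := lor g g = 1 ∧ polarPlane g ∈ 𝓑

section Poles

variable {n : ℕ} {h : ℝ} {𝓑 : Set (Set (Hyp n))} {b g : Vec n}

lemma IsPole.neg (hg : IsPole 𝓑 g) : IsPole 𝓑 (-g) :=
  ⟨by rw [lor_neg_left, lor_neg_right, neg_neg, hg.1], by rw [polarPlane_neg]; exact hg.2⟩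

lemma IsHyperballPacking.exists_pole (hp : IsHyperballPacking h 𝓑) {β : Set (Hyp n)} (hβ : β ∈ 𝓑) :
    ∃ b, IsPole 𝓑 b ∧ polarPlane b = β := by
  obtain ⟨b, hb, rfl⟩ := (hp.isHyperplane β hβ).exists_pole
  exact ⟨b, ⟨hb, hβ⟩, rfl⟩

lemma IsHyperballPacking.eq_or_eq_neg (hh : 0 < h) (hp : IsHyperballPacking h 𝓑)
    (hb : IsPole 𝓑 b) (hg : IsPole 𝓑 g) {x : Hyp n} (hxb : |lor x.1 b| < Real.sinh h)
    (hxg : |lor x.1 g| < Real.sinh h) : g = b ∨ g = -b := by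
  refine eq_or_eq_neg_of_polarPlane_eq hb.1 hg.1 ?_
  by_contra hne
  exact disjoint_left.1 (hp.disjoint _ hb.2 _ hg.2 hne) (mem_interior_hyperball hh hb.1 hxb)
    (mem_interior_hyperball hh hg.1 hxg)

lemma IsHyperballPacking.one_lt_abs_lor (hh : 0 < h) (hp : IsHyperballPacking h 𝓑)
    (hb : IsPole 𝓑 b) (hg : IsPole 𝓑 g) (h1 : g ≠ b) (h2 : g ≠ -b) : 1 < |lor b g| := by
  by_contra! hcon
  have hσ := Real.sinh_pos_iff.2 hh
  obtain ⟨x, hx, hx'⟩ := exists_near_both hb.1 hg.1 hcon h1 h2 hσ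
  rcases hp.eq_or_eq_neg hh hb hg (x := x) (by rwa [hx, abs_zero]) hx' with h3 | h3
  exacts [h1 h3, h2 h3]

lemma mem_dvCell (hp : IsHyperballPacking h 𝓑) (hb : lor b b = 1) {x : Hyp n} :
    x ∈ dvCell 𝓑 (polarPlane b) ↔ ∀ g, IsPole 𝓑 g → |lor x.1 b| ≤ |lor x.1 g| := by
  constructor
  · intro hx g hg
    exact (distTo_le_distTo hb hg.1 x x).1 (hx _ hg.2)
  · intro hx γ hγ
    obtain ⟨g, hg, rfl⟩ := hp.exists_pole hγ
    exact (distTo_le_distTo hb hg.1 x x).2 (hx g hg)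

lemma IsHyperballPacking.finite_norm_le (hh : 0 < h) (hp : IsHyperballPacking h 𝓑) (M : ℝ) :
    {g | IsPole 𝓑 g ∧ ‖g‖ ≤ M}.Finite := by
  let K : Set (Vec n) := {g | lor g g = 1 ∧ ‖g‖ ≤ M}
  have hK : IsCompact K := by
    refine Metric.isCompact_of_isClosed_isBounded ?_ ?_
    · exact (isClosed_eq (by fun_prop) continuous_const).inter
        (isClosed_le continuous_norm continuous_const)
    · exact isBounded_iff_forall_norm_le.2 ⟨M, fun x hx => hx.2⟩
  have hfin : ({g | IsPole 𝓑 g} ∩ K).Finite := by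
    refine hK.induction_on (p := fun s => ({g | IsPole 𝓑 g} ∩ s).Finite) (by simp)
      (fun s t hst ht => ht.subset (inter_subset_inter_right _ hst))
      (fun s t hs ht => by rw [inter_union_distrib_left]; exact hs.union ht) fun g hg => ?_
    -- Poles near `g` have their hyperballs containing this `x` in the interior, so by the packing
    -- property there are at most two of them, opposite to each other.
    obtain ⟨x, hx⟩ := exists_mem_polarPlane hg.1
    refine ⟨{g' | |lor x.1 g'| < Real.sinh h}, mem_nhdsWithin_of_mem_nhds ?_, ?_⟩
    · refine (isOpen_lt (by fun_prop) continuous_const).mem_nhds ?_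
      simpa [hx] using hh
    · by_cases hne : ({g | IsPole 𝓑 g} ∩ {g' | |lor x.1 g'| < Real.sinh h}).Nonempty
      · obtain ⟨b, hb, hxb⟩ := hne
        exact (finite_singleton b |>.insert (-b)).subset fun g' hg' => by
          rcases hp.eq_or_eq_neg hh hb hg'.1 hxb hg'.2 with h1 | h1 <;> simp [h1]
      · rw [not_nonempty_iff_eq_empty.1 hne]
        exact finite_empty
  exact hfin.subset fun g hg => ⟨hg.1, hg.1.1, hg.2⟩

lemma IsHyperballPacking.finite_lor_le (hh : 0 < h) (hp : IsHyperballPacking h 𝓑) (x : Hyp n)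
    (M : ℝ) : {g | IsPole 𝓑 g ∧ |lor x.1 g| ≤ M}.Finite := by
  refine (hp.finite_norm_le hh (2 * x.1 0 * (x.1 0 + M) + 1)).subset fun g hg => ⟨hg.1, ?_⟩
  have h1 := norm_le_of_unit x.2.1 x.2.2 hg.1.1
  have h2 := x.2.2
  have h3 : 2 * x.1 0 * (x.1 0 + |lor x.1 g|) ≤ 2 * x.1 0 * (x.1 0 + M) := by
    gcongr
    exact hg.2
  linarith

lemma IsHyperballPacking.exists_gap (hh : 0 < h) (hp : IsHyperballPacking h 𝓑) (x : Hyp n)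
    (m : ℝ) : ∃ η : ℝ, 0 < η ∧ η ≤ 1 ∧ ∀ g, IsPole 𝓑 g → m < |lor x.1 g| →
      m + η ≤ |lor x.1 g| := by
  have hfin : {g | (IsPole 𝓑 g ∧ |lor x.1 g| ≤ m + 1) ∧ m < |lor x.1 g|}.Finite :=
    (hp.finite_lor_le hh x (m + 1)).subset fun g hg => hg.1
  by_cases hne : {g | (IsPole 𝓑 g ∧ |lor x.1 g| ≤ m + 1) ∧ m < |lor x.1 g|}.Nonempty
  · obtain ⟨g₀, hg₀, hmin⟩ := exists_min_image _ (fun g => |lor x.1 g|) hfin hne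
    refine ⟨|lor x.1 g₀| - m, by linarith [hg₀.2], by linarith [hg₀.1.2], fun g hg hmg => ?_⟩
    by_cases hle : |lor x.1 g| ≤ m + 1
    · linarith [hmin g ⟨⟨hg, hle⟩, hmg⟩]
    · linarith [hg₀.1.2]
  · refine ⟨1, one_pos, le_rfl, fun g hg hmg => ?_⟩
    by_contra! hlt
    exact hne ⟨g, ⟨hg, hlt.le⟩, hmg⟩

lemma abs_lor_le_of_unit (x : Hyp n) : ∃ C : ℝ, 0 < C ∧ ∀ v g : Vec n, lor g g = 1 →
    |lor v g| ≤ C * ‖v‖ * (1 + |lor x.1 g|) := by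
  have hx := x.2.2
  refine ⟨(n + 1) * (2 * x.1 0 * (x.1 0 + 1) + 1), by positivity, fun v g hg => ?_⟩
  have h1 := abs_lor_le v g
  have h2 := norm_le_of_unit x.2.1 hx hg
  have h3 := abs_nonneg (lor x.1 g)
  have h4 : ‖g‖ ≤ (2 * x.1 0 * (x.1 0 + 1) + 1) * (1 + |lor x.1 g|) := by
    refine h2.trans ?_
    nlinarith [mul_nonneg hx.le h3, mul_nonneg (mul_nonneg hx.le hx.le) h3]
  calc |lor v g| ≤ (n + 1) * (‖v‖ * ‖g‖) := h1
    _ ≤ (n + 1) * (‖v‖ * ((2 * x.1 0 * (x.1 0 + 1) + 1) * (1 + |lor x.1 g|))) := by gcongr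
    _ = _ := by ring

/-- Small perturbations preserve the strict inequalities at a point, uniformly over all poles. -/
lemma IsHyperballPacking.eventually_perturb (hh : 0 < h) (hp : IsHyperballPacking h 𝓑) (x : Hyp n)
    (v : Vec n) {m D : ℝ} (hm : 0 ≤ m) (hD : 0 ≤ D) :
    ∀ᶠ ε in 𝓝[>] (0 : ℝ), ∀ g, IsPole 𝓑 g → m < |lor x.1 g| →
      m + ε * (|lor v g| + D) ≤ |lor x.1 g| := by
  obtain ⟨η, hη, hη1, hgap⟩ := hp.exists_gap hh x m
  obtain ⟨C', hC', hbound⟩ := abs_lor_le_of_unit x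
  set C := C' * ‖v‖ with hC
  have hC0 : 0 ≤ C := by positivity
  set E := C + C * m + D + 1 with hE
  have hE0 : 0 < E := by positivity
  filter_upwards [Ioc_mem_nhdsGT (show 0 < η / (2 * E) by positivity)] with ε hε g hg hmg
  have h1 := hgap g hg hmg
  have h2 := hbound v g hg.1
  rw [← hC] at h2
  set t := |lor x.1 g|
  have h3 : ε * (2 * E) ≤ η := (le_div_iff₀ (by positivity)).1 hε.2
  have h4 : ε * (|lor v g| + D) ≤ ε * (C * (1 + t) + D) :=
    mul_le_mul_of_nonneg_left (by linarith) hε.1.le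
  have h5 : ε * (C * (1 + t) + D) = ε * (C + C * m + D) + ε * C * (t - m) := by ring
  have h6 : ε * C ≤ 1 / 2 := by
    have : ε * C ≤ ε * E := mul_le_mul_of_nonneg_left (by rw [hE]; nlinarith [mul_nonneg hC0 hm]) hε.1.le
    linarith
  have h7 : ε * (C + C * m + D) ≤ ε * E := mul_le_mul_of_nonneg_left (by rw [hE]; linarith) hε.1.le
  nlinarith

/-! ### Saturation by horoballs -/

/-- If every pole had `|⟨p, g⟩| ≥ 1`, a sufficiently small horoball centred at `p` would miss all
hyperballs. -/
lemma IsSaturated.exists_abs_lor_lt_one_of_ne_zero (hh : 0 < h) (hp : IsHyperballPacking h 𝓑)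
    (hs : IsSaturated h 𝓑) {p : Vec n} (hpp : lor p p = 0) (hp0 : p ≠ 0) :
    ∃ g, IsPole 𝓑 g ∧ |lor p g| < 1 := by
  by_contra! hcon
  obtain ⟨u, hu, hu0, hug⟩ : ∃ u : Vec n, lor u u = 0 ∧ 0 < u 0 ∧
      ∀ g, IsPole 𝓑 g → 1 ≤ |lor u g| := by
    rcases lt_trichotomy (p 0) 0 with h0 | h0 | h0
    · exact ⟨-p, by rw [lor_neg_left, lor_neg_right, hpp]; ring, by simpa using h0,
        fun g hg => by rw [lor_neg_left, abs_neg]; exact hcon g hg⟩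
    · exact (hp0 (norm_le_zero_iff.1 ((norm_le_of_causal hpp.le h0.ge).trans_eq h0))).elim
    · exact ⟨p, hpp, h0, hcon⟩
  -- A common point of the horoball of `r • u` and the hyperball of `g` forces `|⟨r • u, g⟩| ≤ cosh
  -- h + sinh h = exp h`, so any `r > exp h` works.
  set r := Real.exp h + 1 with hr
  have hr0 : 0 < r := by positivity
  refine hs.no_horoball {x | -lor x.1 (r • u) ≤ 1} ⟨r • u, ?_, ?_, rfl⟩ ?_
  · rw [lor_smul_left, lor_smul_right, hu]; ring
  · exact mul_pos hr0 hu0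
  · intro β hβ
    obtain ⟨g, hg, rfl⟩ := hp.exists_pole hβ
    refine Disjoint.mono interior_subset interior_subset (disjoint_left.2 fun x hx hxg => ?_)
    rw [hyperball_polarPlane hh hg.1] at hxg
    change -lor x.1 (r • u) ≤ 1 at hx
    change |lor x.1 g| ≤ Real.sinh h at hxg
    set τ := -lor x.1 (r • u) with hτ
    have hτ0 : 0 < τ := by
      have := zeroth_le x.2.1 x.2.2 hu.le hu0.le
      have h2 : 0 < -lor x.1 u := by
        by_contra! hle
        have := mul_nonpos_of_nonneg_of_nonpos (mul_pos two_pos x.2.2).le hle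
        linarith
      rw [hτ, lor_smul_right]
      nlinarith
    set s := lor x.1 g
    set d := lor (r • u) g with hd
    have hd1 : r ≤ |d| := by
      rw [hd, lor_smul_left, abs_mul, abs_of_pos hr0]
      exact le_mul_of_one_le_right hr0.le (hug g hg)
    have hcs : ∀ k : ℝ, 0 ≤ 1 + 2 * k * d + (s - k * τ) ^ 2 := by
      intro k
      have := reverse_cauchy_schwarz x.2.1 (g + k • r • u)
      have e1 : lor (g + k • r • u) (g + k • r • u) = 1 + 2 * k * d := by
        rw [hd]
        simp only [lor_add_left, lor_add_right, lor_smul_left, lor_smul_right, hu, hg.1,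
          lor_comm g u]
        ring
      have e2 : lor x.1 (g + k • r • u) = s - k * τ := by
        rw [hτ, lor_add_right, lor_smul_right]
        ring
      rwa [e1, e2] at this
    have hq : (d - s * τ) ^ 2 ≤ τ ^ 2 * (1 + s ^ 2) := by
      -- This `k` minimizes the quadratic polynomial in `hcs`.
      have := hcs (-(d - s * τ) / τ ^ 2)
      have e : 1 + 2 * (-(d - s * τ) / τ ^ 2) * d + (s - -(d - s * τ) / τ ^ 2 * τ) ^ 2 =
          (τ ^ 2 * (1 + s ^ 2) - (d - s * τ) ^ 2) / τ ^ 2 := by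
        field_simp
        ring
      rw [e] at this
      by_contra! hlt
      exact this.not_gt (div_neg_of_neg_of_pos (by linarith) (by positivity))
    have hσ := Real.sinh_pos_iff.2 hh
    have hs2 : s ^ 2 ≤ Real.sinh h ^ 2 := sq_le_sq.2 (by rwa [abs_of_pos hσ])
    have hq2 : |d - s * τ| ≤ Real.cosh h := by
      refine abs_le_of_sq_le_sq ?_ (Real.cosh_pos h).le
      rw [Real.cosh_sq']
      have : τ ^ 2 ≤ 1 := by nlinarith
      nlinarith [sq_nonneg s]
    have hq3 : |s * τ| ≤ Real.sinh h := by
      rw [abs_mul, abs_of_pos hτ0]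
      nlinarith [abs_nonneg s]
    have : |d| ≤ |d - s * τ| + |s * τ| := by
      simpa using abs_add_le (d - s * τ) (s * τ)
    have hexp := Real.cosh_add_sinh h
    linarith

/-- By saturation with respect to horoballs, every ideal point is close to a base plane. -/
lemma IsSaturated.exists_abs_lor_lt_one (hn : 0 < n) (hh : 0 < h) (hp : IsHyperballPacking h 𝓑)
    (hs : IsSaturated h 𝓑) {p : Vec n} (hpp : lor p p = 0) : ∃ g, IsPole 𝓑 g ∧ |lor p g| < 1 := by
  by_cases hp0 : p = 0
  · let i : Fin n := ⟨0, hn⟩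
    let u : Vec n := Pi.single 0 1 + Pi.single i.succ 1
    have hu : lor u u = 0 := by
      simp [u, lor, Pi.single_apply, (Fin.succ_ne_zero _).symm]
    have hu0 : u ≠ 0 := fun h0 => by
      have := congrFun h0 0
      simp [u, (Fin.succ_ne_zero _).symm] at this
    -- For `p = 0` any pole will do; an arbitrary null vector shows that one exists.
    obtain ⟨g, hg, -⟩ := hs.exists_abs_lor_lt_one_of_ne_zero hh hp hu hu0
    exact ⟨g, hg, by rw [hp0, lor_zero_left, abs_zero]; exact one_pos⟩
  · exact hs.exists_abs_lor_lt_one_of_ne_zero hh hp hpp hp0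

end Poles

/-! ### Vertices of the Dirichlet–Voronoi cells -/

section Vertices

variable {n : ℕ} {h : ℝ} {𝓑 : Set (Set (Hyp n))} {P Q : Hyp n} {b g : Vec n}

lemma mem_poles (hp : IsHyperballPacking h 𝓑) :
    b ∈ poles 𝓑 P ↔ IsPole 𝓑 b ∧ lor P.1 b < 0 ∧ ∀ g, IsPole 𝓑 g → |lor P.1 b| ≤ |lor P.1 g| := by
  constructor
  · rintro ⟨h1, h2, h3, h4⟩
    exact ⟨⟨h1, h3⟩, h2, (mem_dvCell hp h1).1 h4⟩
  · rintro ⟨h1, h2, h3⟩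
    exact ⟨h1.1, h2, h1.2, (mem_dvCell hp h1.1).2 h3⟩

lemma finite_poles (hh : 0 < h) (hp : IsHyperballPacking h 𝓑) (P : Hyp n) : (poles 𝓑 P).Finite := by
  by_cases hne : (poles 𝓑 P).Nonempty
  · obtain ⟨b, hb⟩ := hne
    refine (hp.finite_lor_le hh P |lor P.1 b|).subset fun g hg => ?_
    have hg' := (mem_poles hp).1 hg
    exact ⟨hg'.1, hg'.2.2 b ((mem_poles hp).1 hb).1⟩
  · rw [not_nonempty_iff_eq_empty.1 hne]
    exact finite_empty

lemma lor_eq_of_mem_poles (hp : IsHyperballPacking h 𝓑) (hb : b ∈ poles 𝓑 P) (hg : g ∈ poles 𝓑 P) :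
    lor P.1 b = lor P.1 g := by
  obtain ⟨h1, h2, h3⟩ := (mem_poles hp).1 hb
  obtain ⟨h1', h2', h3'⟩ := (mem_poles hp).1 hg
  have := le_antisymm (h3 g h1') (h3' b h1)
  rwa [abs_of_neg h2, abs_of_neg h2', neg_inj] at this

/-- The packing gives `|⟨b, g⟩| > 1`. Since `P` has equal products with both poles, `b - g` is
orthogonal to `P` and hence spacelike, which excludes `⟨b, g⟩ > 1`. -/
lemma lor_lt_of_mem_poles (hh : 0 < h) (hp : IsHyperballPacking h 𝓑) (hb : b ∈ poles 𝓑 P)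
    (hg : g ∈ poles 𝓑 P) (hne : b ≠ g) : lor b g < -1 := by
  obtain ⟨h1, h2, -⟩ := (mem_poles hp).1 hb
  obtain ⟨h1', h2', -⟩ := (mem_poles hp).1 hg
  have hlt := hp.one_lt_abs_lor hh h1 h1' hne.symm (by
    rintro rfl
    rw [lor_neg_right] at h2'
    linarith)
  rcases lt_abs.1 hlt with h3 | h3
  · exfalso
    have h4 := lor_self_pos_of_orthogonal (p := P.1) (v := b - g) (by rw [P.2.1]; norm_num)
      (by rw [lor_sub_right, lor_eq_of_mem_poles hp hb hg, sub_self]) (sub_ne_zero.2 hne)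
    simp only [lor_sub_left, lor_sub_right, h1.1, h1'.1, lor_comm g b] at h4
    linarith
  · linarith

lemma poleConfig_poles (hh : 0 < h) (hp : IsHyperballPacking h 𝓑)
    (hspan : Submodule.span ℝ (poles 𝓑 P) = ⊤) : PoleConfig P (poles 𝓑 P) :=
  ⟨finite_poles hh hp P, hspan, fun _ hb => hb.1,
    fun _ hb _ hg => lor_lt_of_mem_poles hh hp hb hg, fun _ hb => hb.2.1⟩

/-- If `v` is orthogonal to all poles of `P`, a small move along `±v` stays in the cell. As `P` is a
vertex, `v` must be a multiple of `P`, and `⟨P, b⟩ ≠ 0` then gives `v = 0`. -/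
lemma IsDVVertex.span_poles (hh : 0 < h) (hp : IsHyperballPacking h 𝓑) (hP : IsDVVertex 𝓑 P) :
    Submodule.span ℝ (poles 𝓑 P) = ⊤ := by
  obtain ⟨β, hβ, hPβ, hvert⟩ := hP
  obtain ⟨b, hb, rfl⟩ := hp.exists_pole hβ
  have hmin := (mem_dvCell hp hb.1).1 hPβ
  -- Only the base planes nearest to `P` restrict `v`; for all others one small `ε` works uniformly,
  -- by `eventually_perturb`.
  have key : ∀ v : Vec n, (∀ g, IsPole 𝓑 g → |lor P.1 g| = |lor P.1 b| → ∀ ε : ℝ,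
      |lor (P.1 + ε • v) b| ≤ |lor (P.1 + ε • v) g|) → ∃ c : ℝ, v = c • P.1 := by
    intro v hv
    have ht : ∀ w : Vec n, ∀ᶠ ε in 𝓝[>] (0 : ℝ), ∃ y ∈ (univ : Set (Hyp n)), ∃ c : ℝ, 0 < c ∧
        y.1 = c • (P.1 + ε • w) := fun w => by
      have hc : Continuous fun ε : ℝ => P.1 + ε • w := by fun_prop
      have : Tendsto (fun ε : ℝ => P.1 + ε • w) (𝓝[>] 0) (𝓝 P.1) := by
        simpa using (hc.tendsto 0).mono_left nhdsWithin_le_nhds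
      exact this.eventually (eventually_ray_mem univ_mem)
    obtain ⟨ε, ⟨⟨⟨y₁, -, c₁, hc₁, hy₁⟩, y₂, -, c₂, hc₂, hy₂⟩, hε⟩, hε0⟩ :=
      (((ht v).and (ht (-v))).and (hp.eventually_perturb hh P v (abs_nonneg (lor P.1 b))
        (abs_nonneg (lor v b)))).and self_mem_nhdsWithin |>.exists
    have hε0' : 0 < ε := hε0
    have hstep : ∀ ε' : ℝ, |ε'| = ε → ∀ g, IsPole 𝓑 g →
        |lor (P.1 + ε' • v) b| ≤ |lor (P.1 + ε' • v) g| := by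
      intro ε' hε' g hg
      rcases (hmin g hg).lt_or_eq with h1 | h1
      · have h2 := hε g hg h1
        rw [lor_add_left, lor_add_left, lor_smul_left, lor_smul_left]
        have h3 := abs_add_le (lor P.1 b) (ε' * lor v b)
        have h4 := abs_sub_abs_le_abs_sub (lor P.1 g) (-(ε' * lor v g))
        rw [sub_neg_eq_add, abs_neg] at h4
        rw [abs_mul, hε'] at h3 h4
        linarith
      · exact hv g hg h1.symm ε'
    have hcell : ∀ (y : Hyp n) (c ε' : ℝ), 0 < c → |ε'| = ε → y.1 = c • (P.1 + ε' • v) →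
        y ∈ dvCell 𝓑 (polarPlane b) := by
      intro y c ε' hc hε' hy
      rw [mem_dvCell hp hb.1]
      intro g hg
      rw [hy, lor_smul_left, lor_smul_left, abs_mul, abs_mul]
      exact mul_le_mul_of_nonneg_left (hstep ε' hε' g hg) (abs_nonneg c)
    rw [smul_neg, ← neg_smul] at hy₂
    have := (hvert y₁ (hcell y₁ c₁ ε hc₁ (abs_of_pos hε0') hy₁) y₂
      (hcell y₂ c₂ (-ε) hc₂ (by rw [abs_neg, abs_of_pos hε0']) hy₂) (2⁻¹ * c₁⁻¹) (2⁻¹ * c₂⁻¹)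
      (by positivity) (by positivity) (by
        rw [hy₁, hy₂, mul_smul, mul_smul, inv_smul_smul₀ hc₁.ne', inv_smul_smul₀ hc₂.ne', ← smul_add,
          show P.1 + ε • v + (P.1 + -ε • v) = (2 : ℝ) • P.1 by rw [neg_smul, two_smul]; abel,
          inv_smul_smul₀ two_ne_zero])).1
    rw [this] at hy₁
    refine ⟨ε⁻¹ * (c₁⁻¹ - 1), ?_⟩
    have h1 : c₁⁻¹ • P.1 = P.1 + ε • v := by
      conv_lhs => rw [hy₁]
      rw [inv_smul_smul₀ hc₁.ne']
    rw [mul_smul, sub_smul, h1, one_smul, add_sub_cancel_left, inv_smul_smul₀ hε0'.ne']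
  have hmem : ∀ g, IsPole 𝓑 g → |lor P.1 g| = |lor P.1 b| → lor P.1 g < 0 → g ∈ poles 𝓑 P :=
    fun g hg h1 h2 => (mem_poles hp).2 ⟨hg, h2, fun g' hg' => h1 ▸ hmin g' hg'⟩
  by_cases hm : lor P.1 b = 0
  · exfalso
    -- If `P` lay on its base plane, only `±b` would be nearest, so every direction would be
    -- admissible, in particular `b` itself.
    obtain ⟨c, hc⟩ := key b fun g hg hgb ε => by
      rw [hm, abs_zero] at hgb
      have hs := Real.sinh_pos_iff.2 hh
      rcases hp.eq_or_eq_neg hh hb hg (x := P) (by rwa [hm, abs_zero]) (by rwa [hgb]) with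
        h1 | h1
      · rw [h1]
      · rw [h1, lor_neg_right, abs_neg]
    rw [hc, lor_smul_right, P.2.1] at hm
    have hb1 := hb.1
    rw [hc, show c = 0 by linarith, zero_smul, lor_zero_left] at hb1
    linarith
  · have hpm : ∀ g, IsPole 𝓑 g → |lor P.1 g| = |lor P.1 b| → g ∈ poles 𝓑 P ∨ -g ∈ poles 𝓑 P := by
      intro g hg hgb
      have hg0 : lor P.1 g ≠ 0 := fun h0 => by
        rw [h0, abs_zero] at hgb
        exact hm (abs_eq_zero.1 hgb.symm)
      rcases hg0.lt_or_gt with h1 | h1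
      · exact Or.inl (hmem g hg hgb h1)
      · exact Or.inr (hmem (-g) hg.neg (by rw [lor_neg_right, abs_neg, hgb])
          (by rw [lor_neg_right]; linarith))
    refine span_eq_top_of_orthogonal fun v hv => ?_
    have hv' : ∀ g, IsPole 𝓑 g → |lor P.1 g| = |lor P.1 b| → lor v g = 0 := fun g hg hgb => by
      rcases hpm g hg hgb with h1 | h1
      · exact hv g h1
      · have := hv _ h1
        rwa [lor_neg_right, neg_eq_zero] at this
    have hvb := hv' b hb rfl
    obtain ⟨c, hc⟩ := key v fun g hg hgb ε => by
      rw [lor_add_left, lor_add_left, lor_smul_left, lor_smul_left, hvb, hv' g hg hgb, mul_zero,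
        add_zero, add_zero, hgb]
    rw [hc, lor_smul_left] at hvb
    rw [hc, (mul_eq_zero.1 hvb).resolve_right hm, zero_smul]

lemma poles_nonempty (hspan : Submodule.span ℝ (poles 𝓑 P) = ⊤) : (poles 𝓑 P).Nonempty := by
  by_contra hne
  have : P.1 = 0 := eq_zero_of_span hspan fun b hb => (hne ⟨b, hb⟩).elim
  have h1 := P.2.1
  rw [this, lor_zero_left] at h1
  norm_num at h1

/-- As `b + g` is timelike, `⟨x, b⟩ + ⟨x, g⟩` is negative everywhere, so on the cell of `b` the
comparison of absolute values becomes the linear inequality `⟨x, g⟩ ≤ ⟨x, b⟩`. All of these are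
equalities at `P`, and they determine `P` because the poles span. -/
lemma isDVVertex_of_span (hh : 0 < h) (hp : IsHyperballPacking h 𝓑)
    (hspan : Submodule.span ℝ (poles 𝓑 P) = ⊤) : IsDVVertex 𝓑 P := by
  obtain ⟨b, hb⟩ := poles_nonempty hspan
  refine ⟨polarPlane b, hb.2.2.1, hb.2.2.2, ?_⟩
  have hle : ∀ x ∈ dvCell 𝓑 (polarPlane b), ∀ g ∈ poles 𝓑 P, lor x.1 g ≤ lor x.1 b := by
    intro x hx g hg
    by_cases hbg : b = g
    · rw [hbg]
    have hlt := lor_lt_of_mem_poles hh hp hb hg hbg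
    have hx' := (mem_dvCell hp hb.1).1 hx g ⟨hg.1, hg.2.2.1⟩
    have htl : lor (b + g) (b + g) < 0 := by
      simp only [lor_add_left, lor_add_right, hb.1, hg.1, lor_comm g b]
      linarith
    have hs := lor_mul_lor_pos P x htl
    have hPs : lor P.1 (b + g) < 0 := by
      rw [lor_add_right]; linarith [hb.2.1, hg.2.1]
    have hxs : lor x.1 b + lor x.1 g < 0 := by
      rw [← lor_add_right]
      exact neg_of_mul_pos_right hs hPs.le
    by_contra! hcon
    rcases abs_cases (lor x.1 b) with h1 | h1 <;> rcases abs_cases (lor x.1 g) with h2 | h2 <;>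
      linarith
  have heq : ∀ x : Hyp n, (∀ g ∈ poles 𝓑 P, lor x.1 g = lor x.1 b) → x = P := by
    intro x hx
    have h0 : lor P.1 b • x.1 - lor x.1 b • P.1 = 0 := eq_zero_of_span hspan fun g hg => by
      rw [lor_sub_left, lor_smul_left, lor_smul_left, hx g hg, lor_eq_of_mem_poles hp hb hg]
      ring
    refine Hyp.eq_of_smul (c := (lor P.1 b)⁻¹ * lor x.1 b) ?_
    rw [mul_smul, ← sub_eq_zero.1 h0, inv_smul_smul₀ hb.2.1.ne]
  intro x hx y hy s t hs ht hP
  have hxy : ∀ g ∈ poles 𝓑 P, lor x.1 g = lor x.1 b ∧ lor y.1 g = lor y.1 b := by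
    intro g hg
    have h1 := hle x hx g hg
    have h2 := hle y hy g hg
    have h3 := lor_eq_of_mem_poles hp hb hg
    rw [hP] at h3
    simp only [lor_add_left, lor_smul_left] at h3
    constructor <;> nlinarith
  exact ⟨heq x fun g hg => (hxy g hg).1, heq y fun g hg => (hxy g hg).2⟩

/-- The common distance parameter of the base planes of a vertex. -/
lemma exists_level (hp : IsHyperballPacking h 𝓑) (hspan : Submodule.span ℝ (poles 𝓑 P) = ⊤) :
    ∃ m : ℝ, 0 < m ∧ (∀ b ∈ poles 𝓑 P, lor P.1 b = -m) ∧ ∀ g, IsPole 𝓑 g → m ≤ |lor P.1 g| := by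
  obtain ⟨b, hb⟩ := poles_nonempty hspan
  refine ⟨-lor P.1 b, neg_pos.2 hb.2.1, fun g hg => ?_, fun g hg => ?_⟩
  · rw [neg_neg, lor_eq_of_mem_poles hp hb hg]
  · rw [← abs_of_neg hb.2.1]
    exact ((mem_poles hp).1 hb).2.2 g hg

end Vertices

/-! ### The regions of the complement of the base planes -/

/-- A choice of one of the two poles of each base plane. -/
structure IsOrientation {n : ℕ} (𝓑 : Set (Set (Hyp n))) (G : Set (Vec n)) : Prop where
  isPole : ∀ g ∈ G, IsPole 𝓑 g
  mem_or : ∀ g, IsPole 𝓑 g → g ∈ G ∨ -g ∈ G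
  neg_notMem : ∀ g ∈ G, -g ∉ G

/-- The points whose (scaled) distances from the base planes are at least one. -/
def farCone {n : ℕ} (G : Set (Vec n)) : Set (Vec n) := {p | ∀ g ∈ G, lor p g ≤ -1}

section Regions

variable {n : ℕ} {h : ℝ} {𝓑 : Set (Set (Hyp n))} {P Q : Hyp n} {b g p : Vec n} {G : Set (Vec n)}

lemma IsOrientation.one_le_abs (hG : IsOrientation 𝓑 G) (hpG : p ∈ farCone G) (hg : IsPole 𝓑 g) :
    1 ≤ |lor p g| := by
  rcases hG.mem_or g hg with h1 | h1
  · have := hpG g h1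
    rw [abs_of_neg (by linarith)]
    linarith
  · have := hpG _ h1
    rw [lor_neg_right] at this
    rw [abs_of_pos (by linarith)]
    linarith

lemma isClosed_farCone (G : Set (Vec n)) : IsClosed (farCone G) := by
  have : farCone G = ⋂ g ∈ G, {p | lor p g ≤ -1} := by ext; simp [farCone]
  rw [this]
  exact isClosed_biInter fun g _ => isClosed_le (by fun_prop) continuous_const

lemma convex_farCone (G : Set (Vec n)) : Convex ℝ (farCone G) := by
  intro x hx y hy a b ha hb hab g hg
  have h1 := hx g hg
  have h2 := hy g hg
  rw [lor_add_left, lor_smul_left, lor_smul_left]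
  nlinarith

/-- By saturation, all points that are far from all base planes are proper. -/
lemma IsOrientation.timelike (hn : 0 < n) (hh : 0 < h) (hp : IsHyperballPacking h 𝓑)
    (hs : IsSaturated h 𝓑) (hG : IsOrientation 𝓑 G) {q : Vec n} (hq : q ∈ farCone G)
    (hqq : lor q q < 0) (hq0 : 0 < q 0) (hpG : p ∈ farCone G) : lor p p < 0 ∧ 0 < p 0 := by
  -- With no null vector (nor zero) in the convex set `farCone G`, a segment starting at `q` cannot
  -- leave the future light cone.
  have hnl : ∀ r ∈ farCone G, lor r r ≠ 0 := fun r hr h0 => by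
    obtain ⟨g, hg, hlt⟩ := hs.exists_abs_lor_lt_one hn hh hp h0
    linarith [hG.one_le_abs hr hg]
  have hseg : ∀ r ∈ farCone G, ∀ s ∈ Icc (0 : ℝ) 1, (1 - s) • q + s • r ∈ farCone G :=
    fun r hr s hs => convex_farCone G hq hr (by linarith [hs.2]) hs.1 (by ring)
  have htl : ∀ r ∈ farCone G, lor r r < 0 := by
    intro r hr
    by_contra! hcon
    have hc : ContinuousOn (fun s : ℝ => lor ((1 - s) • q + s • r) ((1 - s) • q + s • r))
        (Icc 0 1) := by fun_prop
    obtain ⟨s, hs, hs0⟩ := intermediate_value_Icc zero_le_one hc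
      (show (0 : ℝ) ∈ Icc _ _ by simpa using ⟨hqq.le, hcon⟩)
    exact hnl _ (hseg r hr s hs) hs0
  refine ⟨htl p hpG, ?_⟩
  by_contra! hcon
  have hc : ContinuousOn (fun s : ℝ => ((1 - s) • q + s • p) 0) (Icc 0 1) := by fun_prop
  obtain ⟨s, hs, hs0⟩ := intermediate_value_Icc' zero_le_one hc
    (show (0 : ℝ) ∈ Icc _ _ by simpa using ⟨hcon, hq0.le⟩)
  exact zeroth_ne_zero (htl _ (hseg p hpG s hs)) hs0

/-- Near every point there is, in each adjacent region, a point with a definite distance from all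
base planes. -/
lemma IsHyperballPacking.exists_inner_point (hh : 0 < h) (hp : IsHyperballPacking h 𝓑) (x : Hyp n) :
    ∃ ρ : ℝ, 0 < ρ ∧ ∃ δ : ℝ, 0 < δ ∧ (∀ z : Vec n, ‖z - x.1‖ ≤ ρ → lor z z < 0 ∧ 0 < z 0) ∧
      ∀ G, IsOrientation 𝓑 G → ∀ y : Vec n, ‖y - x.1‖ ≤ ρ → (∀ g ∈ G, lor y g ≤ 0) →
        ∃ z : Vec n, ‖z - x.1‖ ≤ ρ ∧ ∀ g ∈ G, lor z g ≤ -δ := by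
  obtain ⟨η, hη, -, hgap⟩ := hp.exists_gap hh x 0
  obtain ⟨C, hC, hbound⟩ := abs_lor_le_of_unit x
  obtain ⟨ρ₁, hρ₁, hball⟩ : ∃ ρ₁ : ℝ, 0 < ρ₁ ∧ ∀ z : Vec n, ‖z - x.1‖ ≤ ρ₁ →
      lor z z < 0 ∧ 0 < z 0 := by
    have h2 : ∀ᶠ p in 𝓝 x.1, lor p p < 0 :=
      (by fun_prop : Continuous fun p : Vec n => lor p p).continuousAt.eventually_lt
        continuousAt_const (by rw [x.2.1]; norm_num)
    have h3 : ∀ᶠ p in 𝓝 x.1, 0 < p 0 :=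
      continuousAt_const.eventually_lt (continuous_apply (0 : Fin (n + 1))).continuousAt x.2.2
    obtain ⟨ρ, hρ, hsub⟩ := Metric.nhds_basis_closedBall.mem_iff.1 (h2.and h3)
    exact ⟨ρ, hρ, fun z hz => hsub (mem_closedBall_iff_norm.2 hz)⟩
  have hx0 := x.2.2
  set M := 2 * x.1 0 * x.1 0 + 1 with hM
  have hM0 : 0 < M := by positivity
  set ρ := min ρ₁ (η / (2 * C * (1 + η))) with hρdef
  have hρ : 0 < ρ := lt_min hρ₁ (by positivity)
  have hCρ : C * ρ * (2 * (1 + η)) ≤ η := by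
    have := (le_div_iff₀ (by positivity)).1 (min_le_right ρ₁ (η / (2 * C * (1 + η))))
    rw [← hρdef] at this
    linarith
  have hhalf : ∀ v : Vec n, ‖v‖ ≤ ρ → ∀ g, IsPole 𝓑 g → lor x.1 g ≠ 0 →
      |lor v g| ≤ |lor x.1 g| / 2 := by
    intro v hv g hg hg0
    have h1 := hgap g hg (abs_pos.2 hg0)
    have h2 := hbound v g hg.1
    set t := |lor x.1 g|
    have h3 : C * ‖v‖ * (1 + t) ≤ C * ρ * (1 + t) := by gcongr
    have h4 : C * ρ * (1 + t) * (2 * (1 + η)) ≤ η * (1 + t) := by nlinarith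
    have h5 : η * (1 + t) ≤ t * (1 + η) := by linarith
    have h6 : (C * ρ * (1 + t)) * (1 + η) ≤ (t / 2) * (1 + η) := by linarith
    have h7 := le_of_mul_le_mul_right h6 (by positivity)
    linarith
  refine ⟨ρ, hρ, min (η / 2) (ρ / M), by positivity,
    fun z hz => hball z (hz.trans (min_le_left _ _)), fun G hG y hy hyG => ?_⟩
  have hfar : ∀ z : Vec n, ‖z - x.1‖ ≤ ρ → ∀ g ∈ G, lor x.1 g ≠ 0 → lor z g ≤ -(η / 2) := by
    intro z hz g hg hg0
    have h1 := hhalf _ hy g (hG.isPole g hg) hg0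
    have h2 := hhalf _ hz g (hG.isPole g hg) hg0
    have h3 := hgap g (hG.isPole g hg) (abs_pos.2 hg0)
    have h4 := hyG g hg
    rw [lor_sub_left] at h1 h2
    rcases abs_cases (lor x.1 g) with h5 | h5
    · linarith [neg_abs_le (lor y g - lor x.1 g)]
    · linarith [le_abs_self (lor z g - lor x.1 g)]
  -- At most one base plane passes through `x`; if there is one, step off it against its pole,
  -- otherwise take `x` itself.
  by_cases hex : ∃ g₀ ∈ G, lor x.1 g₀ = 0
  · obtain ⟨g₀, hg₀, hxg₀⟩ := hex
    have hnorm : ‖g₀‖ ≤ M := by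
      have := norm_le_of_unit x.2.1 x.2.2 (hG.isPole g₀ hg₀).1
      rwa [hxg₀, abs_zero, add_zero] at this
    have hz : ‖x.1 - (ρ / M) • g₀ - x.1‖ ≤ ρ := by
      rw [sub_sub_cancel_left, norm_neg, norm_smul, Real.norm_of_nonneg (by positivity),
        div_mul_eq_mul_div, div_le_iff₀ hM0]
      gcongr
    refine ⟨x.1 - (ρ / M) • g₀, hz, fun g hg => ?_⟩
    by_cases hg0 : lor x.1 g = 0
    · have hσ := Real.sinh_pos_iff.2 hh
      have hgg : g = g₀ := by
        rcases hp.eq_or_eq_neg hh (hG.isPole g₀ hg₀) (hG.isPole g hg) (x := x)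
          (by rwa [hxg₀, abs_zero]) (by rwa [hg0, abs_zero]) with h1 | h1
        · exact h1
        · exact (hG.neg_notMem g₀ hg₀ (h1 ▸ hg)).elim
      rw [lor_sub_left, lor_smul_left, hg0, hgg, (hG.isPole g₀ hg₀).1]
      linarith [min_le_right (η / 2) (ρ / M)]
    · exact (hfar _ hz g hg hg0).trans (neg_le_neg (min_le_left _ _))
  · push Not at hex
    have hz : ‖x.1 - x.1‖ ≤ ρ := by simpa using hρ.le
    exact ⟨x.1, hz, fun g hg =>
      (hfar _ hz g hg (hex g hg)).trans (neg_le_neg (min_le_left _ _))⟩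

/-- Every point is in a polytope of a vertex. -/
lemma exists_mem_cutPolytope (hn : 0 < n) (hh : 0 < h) (hp : IsHyperballPacking h 𝓑)
    (hs : IsSaturated h 𝓑) (x : Hyp n) : ∃ P, IsDVVertex 𝓑 P ∧ x ∈ cutPolytope (poles 𝓑 P) := by
  obtain ⟨G, hG, hxG⟩ : ∃ G, IsOrientation 𝓑 G ∧ ∀ g ∈ G, lor x.1 g ≤ 0 := by
    obtain ⟨b, hb⟩ : ∃ b : Vec n, ∀ g, IsPole 𝓑 g → lor x.1 g = 0 → IsPole 𝓑 b ∧
        lor x.1 b = 0 ∧ (g = b ∨ g = -b) := by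
      by_cases hex : ∃ b, IsPole 𝓑 b ∧ lor x.1 b = 0
      · obtain ⟨b, hb, hxb⟩ := hex
        have hσ := Real.sinh_pos_iff.2 hh
        exact ⟨b, fun g hg hg0 => ⟨hb, hxb, hp.eq_or_eq_neg hh hb hg (x := x)
          (by rwa [hxb, abs_zero]) (by rwa [hg0, abs_zero])⟩⟩
      · push Not at hex
        exact ⟨0, fun g hg hg0 => (hex g hg hg0).elim⟩
    -- The sign of each pole is dictated by `x`, except for a possible base plane through `x`, where
    -- `b` is chosen.
    refine ⟨{g | IsPole 𝓑 g ∧ (lor x.1 g < 0 ∨ lor x.1 g = 0 ∧ g = b)}, ⟨fun g hg => hg.1, ?_, ?_⟩,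
      ?_⟩
    · intro g hg
      rcases lt_trichotomy (lor x.1 g) 0 with h1 | h1 | h1
      · exact Or.inl ⟨hg, Or.inl h1⟩
      · obtain ⟨-, -, h2 | h2⟩ := hb g hg h1
        · exact Or.inl ⟨hg, Or.inr ⟨h1, h2⟩⟩
        · exact Or.inr ⟨hg.neg, Or.inr ⟨by rw [lor_neg_right, h1, neg_zero], by rw [h2, neg_neg]⟩⟩
      · exact Or.inr ⟨hg.neg, Or.inl (by rw [lor_neg_right]; linarith)⟩
    · rintro g ⟨hg, h1⟩ ⟨-, h2⟩
      rw [lor_neg_right] at h2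
      rcases h1 with h1 | ⟨h1, h1'⟩ <;> rcases h2 with h2 | ⟨h2, h2'⟩
      · linarith
      · linarith
      · linarith
      · have hgg : g = -g := h1'.trans h2'.symm
        have h3 := hg.1
        rw [self_eq_neg.1 hgg, lor_zero_left] at h3
        linarith
    · rintro g ⟨-, h1 | h1⟩
      exacts [h1.le, h1.1.le]
  obtain ⟨ρ, hρ, δ, hδ, hball, hinner⟩ := hp.exists_inner_point hh x
  obtain ⟨z, hz, hzG⟩ := hinner G hG x.1 (by simpa using hρ.le) hxG
  obtain ⟨hzz, hz0⟩ := hball z hz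
  have hq : δ⁻¹ • z ∈ farCone G := fun g hg => by
    rw [lor_smul_left, inv_mul_le_iff₀ hδ]
    linarith [hzG g hg]
  have hqq : lor (δ⁻¹ • z) (δ⁻¹ • z) < 0 := by
    rw [lor_smul_left, lor_smul_right]
    have : 0 < δ⁻¹ := inv_pos.2 hδ
    exact mul_neg_of_pos_of_neg this (mul_neg_of_pos_of_neg this hzz)
  have hq0 : 0 < (δ⁻¹ • z) 0 := mul_pos (inv_pos.2 hδ) hz0
  have htl : ∀ p ∈ farCone G, lor p p < 0 ∧ 0 < p 0 := fun p hpG =>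
    hG.timelike hn hh hp hs hq hqq hq0 hpG
  have hcont : Continuous fun p : Vec n => lor x.1 p := by fun_prop
  have hcomp : IsCompact {p | p ∈ farCone G ∧ lor x.1 (δ⁻¹ • z) ≤ lor x.1 p} := by
    refine Metric.isCompact_of_isClosed_isBounded
      ((isClosed_farCone G).inter (isClosed_le continuous_const hcont)) ?_
    refine isBounded_iff_forall_norm_le.2 ⟨2 * x.1 0 * -lor x.1 (δ⁻¹ • z), fun p hpK => ?_⟩
    obtain ⟨h1, h2⟩ := htl p hpK.1
    have h3 := zeroth_le x.2.1 x.2.2 h1.le h2.le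
    have h4 := norm_le_of_causal h1.le h2.le
    have h5 : 2 * x.1 0 * -lor x.1 p ≤ 2 * x.1 0 * -lor x.1 (δ⁻¹ • z) :=
      mul_le_mul_of_nonneg_left (neg_le_neg hpK.2) (mul_pos two_pos x.2.2).le
    linarith
  -- The linear program: maximize `⟨x, p⟩` over `farCone G`. The superlevel set is compact because
  -- `farCone G` lies in the future light cone.
  obtain ⟨p₁, hp₁, hmax₁⟩ := hcomp.exists_isMaxOn ⟨_, hq, le_rfl⟩ hcont.continuousOn
  have hmax : ∀ p ∈ farCone G, lor x.1 p ≤ lor x.1 p₁ := by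
    intro p hpG
    by_cases hle : lor x.1 (δ⁻¹ • z) ≤ lor x.1 p
    · exact hmax₁ ⟨hpG, hle⟩
    · exact (not_le.1 hle).le.trans hp₁.2
  have hF : IsCompact {p | p ∈ farCone G ∧ lor x.1 p = lor x.1 p₁} :=
    hcomp.of_isClosed_subset ((isClosed_farCone G).inter (isClosed_eq hcont continuous_const))
      fun p hpF => ⟨hpF.1, hp₁.2.trans_eq hpF.2.symm⟩
  -- An extreme point of the optimal face is needed so that the tight poles span.
  obtain ⟨p, ⟨hpG, hpM⟩, hext⟩ := hF.extremePoints_nonempty ⟨p₁, hp₁.1, rfl⟩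
  obtain ⟨hpp, hp0⟩ := htl p hpG
  obtain ⟨c, hc, hPc⟩ := exists_smul_toHyp hpp hp0
  set P := toHyp p hpp hp0
  have hmove : ∀ v : Vec n, (∀ g ∈ G, lor p g = -1 → lor v g ≤ 0) →
      ∃ ε : ℝ, 0 < ε ∧ p + ε • v ∈ farCone G := by
    intro v hv
    obtain ⟨ε, hε, hε0⟩ :=
      ((hp.eventually_perturb hh P v hc.le le_rfl).and self_mem_nhdsWithin).exists
    have hε0' : 0 < ε := hε0
    refine ⟨ε / c, by positivity, fun g hg => ?_⟩
    rw [lor_add_left, lor_smul_left]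
    rcases (hpG g hg).lt_or_eq with h1 | h1
    · have h2 : |lor P.1 g| = -(c * lor p g) := by
        rw [hPc, lor_smul_left, abs_of_neg (mul_neg_of_pos_of_neg hc (by linarith))]
      have h3 := hε g (hG.isPole g hg) (by rw [h2]; nlinarith)
      rw [h2, add_zero] at h3
      have h4 : ε * lor v g ≤ ε * |lor v g| := mul_le_mul_of_nonneg_left (le_abs_self _) hε0'.le
      have h5 : c * (lor p g + ε / c * lor v g) ≤ c * (-1) := by
        have : c * (lor p g + ε / c * lor v g) = c * lor p g + ε * lor v g := by
          field_simp
        linarith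
      exact le_of_mul_le_mul_left h5 hc
    · rw [h1]
      have := mul_nonpos_of_nonneg_of_nonpos (div_pos hε0' hc).le (hv g hg h1)
      linarith
  have htight : ∀ g ∈ G, lor p g = -1 → g ∈ poles 𝓑 P := by
    intro g hg h1
    rw [mem_poles hp]
    refine ⟨hG.isPole g hg, ?_, fun g' hg' => ?_⟩
    · rw [hPc, lor_smul_left, h1]; linarith
    · rw [hPc, lor_smul_left, lor_smul_left, h1, abs_mul, abs_mul]
      refine mul_le_mul_of_nonneg_left ?_ (abs_nonneg c)
      simpa using hG.one_le_abs hpG hg'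
  have hspan : Submodule.span ℝ (poles 𝓑 P) = ⊤ := by
    refine span_eq_top_of_orthogonal fun v hv => ?_
    obtain ⟨ε, hε, h1⟩ := hmove v fun g hg hg1 => (hv g (htight g hg hg1)).le
    obtain ⟨ε', hε', h2⟩ := hmove (-v) fun g hg hg1 => by
      rw [lor_neg_left, hv g (htight g hg hg1), neg_zero]
    have m1 := hmax _ h1
    have m2 := hmax _ h2
    rw [lor_add_right, lor_smul_right, hpM] at m1 m2
    rw [lor_neg_right] at m2
    have hxv : lor x.1 v = 0 := by
      apply le_antisymm <;> nlinarith
    have h3 := hext (x₁ := p + ε • v) ⟨h1, by rw [lor_add_right, lor_smul_right, hxv, hpM]; ring⟩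
      (x₂ := p + ε' • -v)
      ⟨h2, by rw [lor_add_right, lor_smul_right, lor_neg_right, hxv, hpM]; ring⟩
      ⟨ε' / (ε + ε'), ε / (ε + ε'), by positivity, by positivity, by field_simp; ring, by
        rw [smul_add, smul_add, smul_smul, smul_neg, smul_neg, smul_smul, add_add_add_comm,
          ← add_smul, show ε' / (ε + ε') + ε / (ε + ε') = 1 by field_simp; ring, one_smul,
          show ε / (ε + ε') * ε' = ε' / (ε + ε') * ε by ring, add_neg_cancel, add_zero]⟩
    rw [add_eq_left] at h3
    exact (smul_eq_zero.1 h3).resolve_left hε.ne'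
  refine ⟨P, isDVVertex_of_span hh hp hspan, fun b hb => ?_, fun A hA _ => ?_⟩
  · obtain ⟨hb1, hb2, -⟩ := (mem_poles hp).1 hb
    rcases hG.mem_or b hb1 with h1 | h1
    · exact hxG b h1
    · exfalso
      have := hpG _ h1
      rw [lor_neg_right] at this
      rw [hPc, lor_smul_left] at hb2
      nlinarith
  -- `A` is a feasible direction at `p`, so optimality gives `⟨x, A⟩ ≤ 0`.
  · obtain ⟨ε, hε, h1⟩ := hmove A fun g hg hg1 => hA.2.1 g (htight g hg hg1)
    have := hmax _ h1
    rw [lor_add_right, lor_smul_right, hpM] at this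
    by_contra! hcon
    nlinarith

/-- No base plane, whether or not its pole is in `S(P)`, crosses the polytope of `P`. If `⟨g, b⟩ ≤
0` for all poles `b` of `P`, this is a dual condition. Otherwise some `g - b` is timelike, so `⟨x,
g⟩ < ⟨x, b⟩ ≤ 0` because this order holds at `P`. -/
lemma lor_nonpos_of_mem_cutPolytope (hn : 1 < n) (hh : 0 < h) (hp : IsHyperballPacking h 𝓑)
    (hspan : Submodule.span ℝ (poles 𝓑 P) = ⊤) {x : Hyp n} (hx : x ∈ cutPolytope (poles 𝓑 P))
    (hg : IsPole 𝓑 g) (hPg : lor P.1 g < 0) : lor x.1 g ≤ 0 := by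
  rw [(poleConfig_poles hh hp hspan).cutPolytope_eq hn] at hx
  by_cases hall : g ∈ halfspaceCone (poles 𝓑 P)
  · exact hx.2 g hall
  obtain ⟨b, hb, hbg⟩ : ∃ b ∈ poles 𝓑 P, 0 < lor g b := by
    simpa [halfspaceCone] using hall
  by_cases hgb : g = b
  · rw [hgb]; exact hx.1 b hb
  obtain ⟨hb1, hb2, hb3⟩ := (mem_poles hp).1 hb
  have hlt := hp.one_lt_abs_lor hh hb1 hg hgb (by
    rintro rfl
    rw [lor_neg_right] at hPg
    linarith)
  rw [lor_comm, abs_of_pos hbg] at hlt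
  have htl : lor (g - b) (g - b) < 0 := by
    simp only [lor_sub_left, lor_sub_right, hg.1, hb1.1, lor_comm b g]
    linarith
  have hsgn := lor_mul_lor_pos P x htl
  have h1 := hb3 g hg
  rw [abs_of_neg hb2, abs_of_neg hPg] at h1
  rw [lor_sub_right, lor_sub_right] at hsgn
  have h2 := neg_of_mul_pos_right hsgn (by linarith)
  linarith [hx.1 b hb]

lemma lor_ne_zero_of_span (hp : IsHyperballPacking h 𝓑)
    (hspan : Submodule.span ℝ (poles 𝓑 P) = ⊤) (hg : IsPole 𝓑 g) : lor P.1 g ≠ 0 := by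
  obtain ⟨m, hm, -, hle⟩ := exists_level hp hspan
  exact abs_pos.1 (hm.trans_le (hle g hg))

lemma poles_injective (hp : IsHyperballPacking h 𝓑) (hspan : Submodule.span ℝ (poles 𝓑 P) = ⊤)
    (h' : Submodule.span ℝ (poles 𝓑 Q) = ⊤) (heq : poles 𝓑 P = poles 𝓑 Q) : P = Q := by
  obtain ⟨m, hm, hm1, -⟩ := exists_level hp hspan
  obtain ⟨k, hk, hk1, -⟩ := exists_level hp h'
  have h0 : k • P.1 - m • Q.1 = 0 := eq_zero_of_span hspan fun b hb => by
    rw [lor_sub_left, lor_smul_left, lor_smul_left, hm1 b hb, hk1 b (heq ▸ hb)]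
    ring
  refine Hyp.eq_of_smul (c := k⁻¹ * m) ?_
  rw [mul_smul, ← sub_eq_zero.1 h0, inv_smul_smul₀ hk.ne']

/-- A base plane between `P` and `Q` separates the polytopes. Otherwise the rescaled vertices `P /
m` and `Q / k` satisfy the same system `⟨p, g⟩ ≤ -1`; each is optimal for the points of its own
polytope, so the hyperplane orthogonal to their difference separates. -/
lemma disjoint_interior_cutPolytope (hn : 1 < n) (hh : 0 < h) (hp : IsHyperballPacking h 𝓑)
    (hP : Submodule.span ℝ (poles 𝓑 P) = ⊤) (hQ : Submodule.span ℝ (poles 𝓑 Q) = ⊤) (hne : P ≠ Q) :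
    Disjoint (interior (cutPolytope (poles 𝓑 P))) (interior (cutPolytope (poles 𝓑 Q))) := by
  by_cases hsep : ∃ g, IsPole 𝓑 g ∧ lor P.1 g < 0 ∧ 0 < lor Q.1 g
  · obtain ⟨g, hg, hPg, hQg⟩ := hsep
    refine disjoint_interior_of_orthogonal (v := g) ?_ fun x hx hx' => ?_
    · rintro rfl
      simp [lor_zero_right] at hPg
    · have h1 := lor_nonpos_of_mem_cutPolytope hn hh hp hP hx hg hPg
      have h2 := lor_nonpos_of_mem_cutPolytope hn hh hp hQ hx' hg.neg
        (by rw [lor_neg_right]; linarith)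
      rw [lor_neg_right] at h2
      linarith
  push Not at hsep
  obtain ⟨m, hm, hm1, hm2⟩ := exists_level hp hP
  obtain ⟨k, hk, hk1, hk2⟩ := exists_level hp hQ
  have hv : k⁻¹ • Q.1 - m⁻¹ • P.1 ∈ halfspaceCone (poles 𝓑 P) := by
    intro b hb
    obtain ⟨hb1, hb2, -⟩ := (mem_poles hp).1 hb
    have h1 := hsep b hb1 hb2
    have h2 := hk2 b hb1
    rw [abs_of_nonpos h1] at h2
    rw [lor_sub_left, lor_smul_left, lor_smul_left, hm1 b hb, mul_neg, inv_mul_cancel₀ hm.ne']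
    have : k⁻¹ * lor Q.1 b ≤ -1 := by
      rw [inv_mul_le_iff₀ hk]; linarith
    linarith
  have hw : m⁻¹ • P.1 - k⁻¹ • Q.1 ∈ halfspaceCone (poles 𝓑 Q) := by
    intro b hb
    obtain ⟨hb1, hb2, -⟩ := (mem_poles hp).1 hb
    have h1 : lor P.1 b < 0 := by
      rcases (lor_ne_zero_of_span hp hP hb1).lt_or_gt with h0 | h0
      · exact h0
      · have := hsep (-b) hb1.neg (by rw [lor_neg_right]; linarith)
        rw [lor_neg_right] at this
        linarith
    have h2 := hm2 b hb1
    rw [abs_of_neg h1] at h2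
    rw [lor_sub_left, lor_smul_left, lor_smul_left, hk1 b hb, mul_neg, inv_mul_cancel₀ hk.ne']
    have : m⁻¹ * lor P.1 b ≤ -1 := by
      rw [inv_mul_le_iff₀ hm]; linarith
    linarith
  refine disjoint_interior_of_orthogonal (v := k⁻¹ • Q.1 - m⁻¹ • P.1) ?_ fun x hx hx' => ?_
  · intro h0
    apply hne
    refine Hyp.eq_of_smul (c := m * k⁻¹) ?_
    rw [mul_smul, sub_eq_zero.1 h0, smul_inv_smul₀ hm.ne']
  · rw [(poleConfig_poles hh hp hP).cutPolytope_eq hn] at hx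
    rw [(poleConfig_poles hh hp hQ).cutPolytope_eq hn] at hx'
    have h1 := hx.2 _ hv
    have h2 := hx'.2 _ hw
    rw [lor_sub_right] at h1 h2 ⊢
    linarith

/-- Let the polytope of `P` contain a point `y` near `x`, and let `p = P / m`. Optimality of `p`
compares it with an inner point `z` of the same region, whose depth `δ` does not depend on the
region; this bounds `p`. A compact set without null vectors keeps `⟨p, p⟩ = -1 / m²` away from zero,
which bounds `m`, then `P`, then its poles. Finitely many pole sets remain, and they determine `P`.
-/
lemma locallyFinite_cutPolytope (hn : 1 < n) (hh : 0 < h) (hp : IsHyperballPacking h 𝓑)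
    (hs : IsSaturated h 𝓑) :
    LocallyFinite fun P : {P : Hyp n // IsDVVertex 𝓑 P} => cutPolytope (poles 𝓑 P.1) := by
  intro x
  obtain ⟨ρ, hρ, δ, hδ, hball, hinner⟩ := hp.exists_inner_point hh x
  set R := ‖x.1‖ + ρ with hR
  have hR0 : 0 ≤ R := by positivity
  have hnorm : ∀ z : Vec n, ‖z - x.1‖ ≤ ρ → ‖z‖ ≤ R := fun z hz => by
    have := norm_add_le (z - x.1) x.1
    rw [sub_add_cancel] at this
    linarith
  set C₁ := (n + 1) * (R * (δ⁻¹ * R)) with hC₁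
  have hC₁0 : 0 ≤ C₁ := by positivity
  set C₂ := 2 * R * C₁ with hC₂
  have hC₂0 : 0 ≤ C₂ := by positivity
  let K : Set (Vec n) := {q | ‖q‖ ≤ C₂ ∧ ∀ g, IsPole 𝓑 g → 1 ≤ |lor q g|}
  have hK : IsCompact K := by
    refine Metric.isCompact_of_isClosed_isBounded ?_ ?_
    · refine (isClosed_le continuous_norm continuous_const).inter ?_
      have : {q : Vec n | ∀ g, IsPole 𝓑 g → 1 ≤ |lor q g|} =
          ⋂ g ∈ {g | IsPole 𝓑 g}, {q | 1 ≤ |lor q g|} := by ext; simp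
      change IsClosed {q : Vec n | ∀ g, IsPole 𝓑 g → 1 ≤ |lor q g|}
      rw [this]
      exact isClosed_biInter fun g _ => isClosed_le continuous_const (by fun_prop)
    · exact isBounded_iff_forall_norm_le.2 ⟨C₂, fun q hq => hq.1⟩
  -- Saturation enters here: a null vector has product less than one in absolute value with some
  -- pole, so `K` contains none.
  obtain ⟨κ, hκ, hκK⟩ := hK.exists_forall_le' (f := fun q => |lor q q|) (a := 0)
    (by fun_prop) fun q hq => abs_pos.2 fun h0 => by
      obtain ⟨g, hg, hlt⟩ := hs.exists_abs_lor_lt_one (by omega) hh hp h0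
      linarith [hq.2 g hg]
  set m₀ := κ⁻¹ + 1 with hm₀
  have hm₀0 : 0 < m₀ := by positivity
  set M := 2 * (m₀ * C₂) * (m₀ * C₂ + m₀) + 1 with hM
  refine ⟨{y | ‖y.1 - x.1‖ < ρ}, (isOpen_lt (by fun_prop) continuous_const).mem_nhds
    (by simpa using hρ), ?_⟩
  refine Finite.of_injOn (f := fun P => poles 𝓑 P.1) (t := 𝒫 {g | IsPole 𝓑 g ∧ ‖g‖ ≤ M}) ?_ ?_
    (hp.finite_norm_le hh M).finite_subsets
  swap
  · intro P _ Q _ hPQ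
    exact Subtype.ext (poles_injective hp (P.2.span_poles hh hp) (Q.2.span_poles hh hp) hPQ)
  rintro ⟨P, hP⟩ ⟨y, hy, hyx⟩ b hb
  replace hy : y ∈ cutPolytope (poles 𝓑 P) := hy
  have hspan := hP.span_poles hh hp
  have hyx' : ‖y.1 - x.1‖ ≤ ρ := le_of_lt hyx
  obtain ⟨m, hm, hm1, hm2⟩ := exists_level hp hspan
  have hG : IsOrientation 𝓑 {g | IsPole 𝓑 g ∧ lor P.1 g < 0} := by
    refine ⟨fun g hg => hg.1, fun g hg => ?_, fun g hg hg' => ?_⟩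
    · rcases (lor_ne_zero_of_span hp hspan hg).lt_or_gt with h0 | h0
      · exact Or.inl ⟨hg, h0⟩
      · exact Or.inr ⟨hg.neg, by rw [lor_neg_right]; linarith⟩
    · have h1 := hg.2
      have h2 := hg'.2
      rw [lor_neg_right] at h2
      linarith
  obtain ⟨z, hz, hzG⟩ := hinner _ hG y.1 hyx' fun g hg =>
    lor_nonpos_of_mem_cutPolytope hn hh hp hspan hy hg.1 hg.2
  set p := m⁻¹ • P.1 with hpdef
  have hmi : 0 < m⁻¹ := inv_pos.2 hm
  have hpp : lor p p = -(m⁻¹ ^ 2) := by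
    rw [hpdef, lor_smul_left, lor_smul_right, P.2.1]; ring
  have hp0 : 0 < p 0 := mul_pos hmi P.2.2
  have hcone : δ⁻¹ • z - p ∈ halfspaceCone (poles 𝓑 P) := by
    intro b hb
    obtain ⟨hb1, hb2, -⟩ := (mem_poles hp).1 hb
    rw [lor_sub_left, hpdef, lor_smul_left, lor_smul_left, hm1 b hb, mul_neg,
      inv_mul_cancel₀ hm.ne']
    have : δ⁻¹ * lor z b ≤ -1 := by
      rw [inv_mul_le_iff₀ hδ]; linarith [hzG b ⟨hb1, hb2⟩]
    linarith
  rw [(poleConfig_poles hh hp hspan).cutPolytope_eq hn] at hy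
  have h1 := hy.2 _ hcone
  rw [lor_sub_right] at h1
  have h2 : |lor y.1 (δ⁻¹ • z)| ≤ C₁ := by
    refine (abs_lor_le _ _).trans ?_
    rw [norm_smul, Real.norm_of_nonneg (inv_pos.2 hδ).le, hC₁]
    have := hnorm z hz
    have := hnorm y.1 hyx'
    gcongr
  have hppneg : lor p p < 0 := by rw [hpp]; exact neg_neg_of_pos (by positivity)
  have h3 : p 0 ≤ C₂ := by
    have h4 := zeroth_le y.2.1 y.2.2 hppneg.le hp0.le
    have h5 : -lor y.1 p ≤ C₁ := by linarith [neg_abs_le (lor y.1 (δ⁻¹ • z))]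
    have h6 : y.1 0 ≤ R := by
      have := norm_le_pi_norm y.1 0
      rw [Real.norm_of_nonneg y.2.2.le] at this
      exact this.trans (hnorm y.1 hyx')
    calc p 0 ≤ 2 * y.1 0 * -lor y.1 p := h4
      _ ≤ 2 * y.1 0 * C₁ := mul_le_mul_of_nonneg_left h5 (mul_pos two_pos y.2.2).le
      _ ≤ 2 * R * C₁ := by gcongr
  have h7 : κ ≤ m⁻¹ ^ 2 := by
    have := hκK p ⟨(norm_le_of_causal hppneg.le hp0.le).trans h3, fun g hg => by
      rw [hpdef, lor_smul_left, abs_mul, abs_of_pos hmi, ← div_eq_inv_mul, le_div_iff₀ hm, one_mul]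
      exact hm2 g hg⟩
    rwa [hpp, abs_neg, abs_of_pos (by positivity)] at this
  have h8 : m ≤ m₀ := by
    have h9 : κ * m ^ 2 ≤ 1 := by
      rwa [inv_pow, ← one_div, le_div_iff₀ (by positivity)] at h7
    have h10 : m ^ 2 ≤ κ⁻¹ := by
      rw [← one_div, le_div_iff₀ hκ]; linarith
    have : 0 < κ⁻¹ := inv_pos.2 hκ
    nlinarith
  have h11 : P.1 0 ≤ m₀ * C₂ := by
    have : P.1 0 = m * p 0 := by
      rw [hpdef, Pi.smul_apply, smul_eq_mul, mul_inv_cancel_left₀ hm.ne']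
    rw [this]
    gcongr
  obtain ⟨hb1, hb2, -⟩ := (mem_poles hp).1 hb
  refine ⟨hb1, (norm_le_of_unit P.2.1 P.2.2 hb1.1).trans ?_⟩
  rw [hm1 b hb, abs_neg, abs_of_pos hm, hM]
  have := P.2.2
  gcongr

end Regions

/-! ### The decompositions -/

section Decomposition

variable {n : ℕ} {h : ℝ} {𝓑 : Set (Set (Hyp n))} {P : Hyp n} {S : Set (Vec n)}

lemma isDecomposition_cutPolytope (hn : 1 < n) (hh : 0 < h) (hp : IsHyperballPacking h 𝓑)
    (hs : IsSaturated h 𝓑) : IsDecomposition Set.univ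
      (fun P : {P : Hyp n // IsDVVertex 𝓑 P} => cutPolytope (poles 𝓑 P.1)) where
  isCompact P := (poleConfig_poles hh hp (P.2.span_poles hh hp)).isCompact_cutPolytope hn
  nonempty P := (poleConfig_poles hh hp (P.2.span_poles hh hp)).nonempty_interior hn
  covers := by
    refine eq_univ_of_forall fun x => mem_iUnion.2 ?_
    obtain ⟨P, hP, hx⟩ := exists_mem_cutPolytope (by omega) hh hp hs x
    exact ⟨⟨P, hP⟩, hx⟩
  disjoint P Q hne := disjoint_interior_cutPolytope hn hh hp (P.2.span_poles hh hp)
    (Q.2.span_poles hh hp) fun h => hne (Subtype.ext h)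
  locallyFinite := locallyFinite_cutPolytope hn hh hp hs

lemma CutResult.finite {𝒯 : Set (Set (Vec n))} (h : CutResult S 𝒯) (hS : PoleConfig P S) :
    𝒯.Finite :=
  hS.finite.finite_subsets.subset fun T hT => ((h.spec hS).1 T hT).1

lemma CutResult.poleConfig {𝒯 : Set (Set (Vec n))} (h : CutResult S 𝒯) (hS : PoleConfig P S)
    {T : Set (Vec n)} (hT : T ∈ 𝒯) : PoleConfig P T :=
  hS.subset ((h.spec hS).1 T hT).1 ((h.spec hS).1 T hT).2.1

lemma CutResult.isDecomposition {𝒯 : Set (Set (Vec n))} (hn : 1 < n) (h : CutResult S 𝒯)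
    (hS : PoleConfig P S) :
    IsDecomposition (cutPolytope S) (fun T : {T // T ∈ 𝒯} => cutPolytope T.1) where
  isCompact T := (h.poleConfig hS T.2).isCompact_cutPolytope hn
  nonempty T := (h.poleConfig hS T.2).nonempty_interior hn
  covers := by rw [(h.spec hS).2.1, iUnion_subtype]
  disjoint T T' hne := (h.spec hS).2.2 T.1 T.2 T'.1 T'.2 fun h => hne (Subtype.ext h)
  locallyFinite := by
    have := (h.finite hS).to_subtype
    exact locallyFinite_of_finite _

/-- A decomposition can be refined by finite decompositions of its tiles. -/
lemma IsDecomposition.sigma {ι : Type} {κ : ι → Type} {X : Set (Hyp n)} {D : ι → Set (Hyp n)}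
    {E : ∀ i, κ i → Set (Hyp n)} [∀ i, Finite (κ i)] (hD : IsDecomposition X D)
    (hE : ∀ i, IsDecomposition (D i) (E i)) :
    IsDecomposition X (fun q : Σ i, κ i => E q.1 q.2) := by
  have hsub : ∀ i k, E i k ⊆ D i := fun i k => (hE i).covers ▸ subset_iUnion (E i) k
  refine ⟨fun q => (hE q.1).isCompact q.2, fun q => (hE q.1).nonempty q.2, ?_, ?_, ?_⟩
  · rw [iUnion_sigma, ← hD.covers]
    exact iUnion_congr fun i => (hE i).covers
  · rintro ⟨i, k⟩ ⟨j, l⟩ hne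
    by_cases hij : i = j
    · subst hij
      exact (hE i).disjoint k l fun h => hne (by rw [h])
    · exact (hD.disjoint i j hij).mono (interior_mono (hsub i k)) (interior_mono (hsub j l))
  · intro x
    obtain ⟨U, hU, hfin⟩ := hD.locallyFinite x
    refine ⟨U, hU, (hfin.biUnion (t := fun i => range (Sigma.mk i))
      fun i _ => finite_range _).subset ?_⟩
    rintro ⟨i, k⟩ ⟨y, hy, hyU⟩
    exact mem_biUnion (x := i) ⟨y, hsub i k hy, hyU⟩ ⟨k, rfl⟩

lemma CutResult.isTruncatedSimplex {𝒯 : Set (Set (Vec n))} (hn : 1 < n) (hh : 0 < h)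
    (hp : IsHyperballPacking h 𝓑) (hspan : Submodule.span ℝ (poles 𝓑 P) = ⊤)
    (hcut : CutResult (poles 𝓑 P) 𝒯) {T : Set (Vec n)} (hT : T ∈ 𝒯) :
    ∃ B : Fin (n + 1) → Vec n,
      Set.range B = T ∧ IsTruncatedSimplex B (cutPolytope T) ∧
      (∀ i, polarPlane (B i) ∈ 𝓑) ∧
      ∀ i j, i ≠ j →
        polarPlane (B i) ≠ polarPlane (B j) ∧
        Disjoint (interior (hyperball h (polarPlane (B i)) ∩ cutPolytope T))
          (interior (hyperball h (polarPlane (B j)) ∩ cutPolytope T)) := by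
  have hS := poleConfig_poles hh hp hspan
  obtain ⟨hsub, -, hno⟩ := (hcut.spec hS).1 T hT
  have hTc := hcut.poleConfig hS hT
  obtain ⟨B, hB, hsimp⟩ := hTc.isTruncatedSimplex hn (hTc.linearIndependent hn hno)
  have hBmem : ∀ i, B i ∈ poles 𝓑 P := fun i => hsub (hB ▸ mem_range_self i)
  have hpole : ∀ i, IsPole 𝓑 (B i) := fun i => ((mem_poles hp).1 (hBmem i)).1
  refine ⟨B, hB, hsimp, fun i => (hpole i).2, fun i j hij => ?_⟩
  have hlt := hsimp.edge i j hij
  have hne : polarPlane (B i) ≠ polarPlane (B j) := by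
    intro heq
    rcases eq_or_eq_neg_of_polarPlane_eq (hpole i).1 (hpole j).1 heq with h1 | h1
    · rw [h1, (hpole i).1] at hlt
      linarith
    · rw [h1, lor_neg_right, (hpole i).1] at hlt
      linarith
  exact ⟨hne, (hp.disjoint _ (hpole i).2 _ (hpole j).2 hne).mono
    (interior_mono inter_subset_left) (interior_mono inter_subset_left)⟩

end Decomposition

end HyperballPacking

end

/-! ### The theorem -/

open HyperballPacking in
theorem theorem3p2 (n : ℕ) (hn : 3 < n) (h : ℝ) (hh : 0 < h) (𝓑 : Set (Set (Hyp n)))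
    (hpack : IsHyperballPacking h 𝓑) (hsat : IsSaturated h 𝓑) :
    -- the polytopes belonging to the Dirichlet-Voronoi vertices decompose hyperbolic space
    IsDecomposition Set.univ
      (fun P : {P : Hyp n // IsDVVertex 𝓑 P} => cutPolytope (poles 𝓑 P.1)) ∧
    -- the cutting procedure can always be continued and terminates
    (∀ P : Hyp n, IsDVVertex 𝓑 P →
      (poles 𝓑 P).Finite ∧
      (∀ S ⊆ poles 𝓑 P, Submodule.span ℝ S = ⊤ →
        (∃ A, IsCuttingPoint S A) → ∃ 𝒞, IsCut S 𝒞) ∧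
      ∃ 𝒯, CutResult (poles 𝓑 P) 𝒯) ∧
    -- whatever cuts are chosen, the result is a decomposition into truncated simplices
    ∀ 𝒯 : Hyp n → Set (Set (Vec n)),
      (∀ P : Hyp n, IsDVVertex 𝓑 P → CutResult (poles 𝓑 P) (𝒯 P)) →
      (∀ P : Hyp n, IsDVVertex 𝓑 P → (𝒯 P).Finite ∧
        IsDecomposition (cutPolytope (poles 𝓑 P)) (fun T : {T // T ∈ 𝒯 P} => cutPolytope T.1)) ∧
      IsDecomposition Set.univ
        (fun q : (Σ P : {P : Hyp n // IsDVVertex 𝓑 P}, {T // T ∈ 𝒯 P.1}) =>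
          cutPolytope q.2.1) ∧
      ∀ P : Hyp n, IsDVVertex 𝓑 P → ∀ T ∈ 𝒯 P, ∃ B : Fin (n + 1) → Vec n,
        Set.range B = T ∧ IsTruncatedSimplex B (cutPolytope T) ∧
        -- the truncating hyperplanes are base planes, and their hyperballs form a packing
        (∀ i, polarPlane (B i) ∈ 𝓑) ∧
        ∀ i j, i ≠ j →
          polarPlane (B i) ≠ polarPlane (B j) ∧
          Disjoint (interior (hyperball h (polarPlane (B i)) ∩ cutPolytope T))
            (interior (hyperball h (polarPlane (B j)) ∩ cutPolytope T)) := by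
  have hn1 : 1 < n := by omega
  have hspan := fun (P : Hyp n) (hP : IsDVVertex 𝓑 P) => hP.span_poles hh hpack
  have hconf := fun (P : Hyp n) (hP : IsDVVertex 𝓑 P) => poleConfig_poles hh hpack (hspan P hP)
  have hdec := isDecomposition_cutPolytope hn1 hh hpack hsat
  refine ⟨hdec, fun P hP => ⟨(hconf P hP).finite, fun S hS hSspan hA => ?_,
    (hconf P hP).exists_cutResult hn1⟩, fun 𝒯 h𝒯 => ⟨fun P hP =>
    ⟨(h𝒯 P hP).finite (hconf P hP), (h𝒯 P hP).isDecomposition hn1 (hconf P hP)⟩, ?_,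
    fun P hP T hT => (h𝒯 P hP).isTruncatedSimplex hn1 hh hpack (hspan P hP) hT⟩⟩
  · obtain ⟨A, hA⟩ := hA
    exact ((hconf P hP).subset hS hSspan).exists_isCut_of_isCuttingPoint hn1 hA
  · have : ∀ P : {P : Hyp n // IsDVVertex 𝓑 P}, Finite {T // T ∈ 𝒯 P.1} := fun P =>
      ((h𝒯 P.1 P.2).finite (hconf P.1 P.2)).to_subtype
    exact hdec.sigma (E := fun P (T : {T // T ∈ 𝒯 P.1}) => cutPolytope T.1)
      fun P => (h𝒯 P.1 P.2).isDecomposition hn1 (hconf P.1 P.2)
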